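/- Let $(V_0,R,V_0^\vee,R^\vee)$ be a finite reduced (not necessarily crystallographic) real root system of type $I_2(n)$ with $n\ge 3$, $H_3$ or $H_4$; the noncrystallographic root systems are among these, namely $I_2(n)$ with $n=5$ or $n\ge 7$, $H_3$ and $H_4$. Let $W$ be its reflection group, acting on $V_0^\vee$, and fix a $W$-invariant inner product $\langle\cdot,\cdot\rangle$ on $V_0^\vee$. Let $C(V_0^\vee)$ be the real Clifford algebra with relations $\omega\omega'+\omega'\omega=-2\langle\omega,\omega'\rangle$, let $\epsilon$ be its automorphism and ${}^t$ its anti-automorphism that are $-1$ on $V_0^\vee$, let $$\mathrm{Pin}(V_0^\vee)=\{a\in C(V_0^\vee)^\times : \epsilon(a)V_0^\vee a^{-1}\subset V_0^\vee,\ a^t=a^{-1}\},\qquad p(a)\omega=\epsilon(a)\,\omega\, a^{-1},$$ and let $\widetilde W=p^{-1}(W)$, a double cover of $W$. Let $S$ be a spin module, that is, a simple module over the complex Clifford algebra $C(\mathbb C\otimes V_0^\vee)$, regarded as a representation of $\widetilde W\subset C(V_0^\vee)^\times\subset C(\mathbb C\otimes V_0^\vee)^\times$. (There is one such $S$ up to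 isomorphism if $\dim V_0$ is even, and there are two if $\dim V_0$ is odd; the statement holds for each.) For a finite group $\Gamma$ let $R(\Gamma)$ be its representation ring with complex coefficients, and let $R_{\mathrm{gen}}(\widetilde W)\subset R(\widetilde W)$ be the subspace spanned by the genuine irreducible representations, i.e. those that do not factor through $p:\widetilde W\to W$. Then $\sigma\mapsto\sigma\otimes S$ defines a linear map $i_S:R(W)\to R_{\mathrm{gen}}(\widetilde W)$, and $i_S$ is surjective if and only if $R$ is of type $I_2(n)$ with $n$ even, of type $H_3$, or of type $H_4$. -/

import Mathlib

open CategoryTheory CategoryTheory.Limits CategoryTheory.MonoidalCategory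
open scoped TensorProduct

noncomputable section

namespace SpinCover

/-! ### Types of root systems -/

section RootSystems

variable {ι V₀ V₀' : Type*} [AddCommGroup V₀] [Module ℝ V₀] [AddCommGroup V₀'] [Module ℝ V₀']

/-- The family `α` of roots is a system of simple roots: it is linearly independent, and every root
is a combination of its members with real coefficients that are all `≥ 0` or all `≤ 0`. -/
structure IsSimpleSystem {b : Type*} [Fintype b] (P : RootPairing ι ℝ V₀ V₀') (α : b → ι) :
    Prop where
  linearIndependent : LinearIndependent ℝ fun s => P.root (α s)
  nonneg_or_nonpos : ∀ i : ι, ∃ c : b → ℝ, P.root i = ∑ s, c s • P.root (α s) ∧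
    ((∀ s, 0 ≤ c s) ∨ (∀ s, c s ≤ 0))

/-- `P` has the Coxeter diagram described by the Coxeter matrix `M`: for some system of simple
roots, indexed by the vertices of the diagram, the product of the simple reflections
at `s` and `t` has order `M s t`. -/
def HasCoxeterType {b : Type*} [Fintype b] (P : RootPairing ι ℝ V₀ V₀') (M : CoxeterMatrix b) :
    Prop :=
  ∃ α : b → ι, IsSimpleSystem P α ∧
    ∀ s t : b, orderOf (P.reflection (α s) * P.reflection (α t)) = M s t

/-- Type `I₂(n)`. In Mathlib, `CoxeterMatrix.I m` is the diagram with two vertices and an edge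
labelled `m + 2`. -/
def IsTypeI₂ (P : RootPairing ι ℝ V₀ V₀') (n : ℕ) : Prop :=
  ∃ m : ℕ, n = m + 2 ∧ HasCoxeterType P (CoxeterMatrix.I m)

/-- Type `H₃`. -/
def IsTypeH₃ (P : RootPairing ι ℝ V₀ V₀') : Prop := HasCoxeterType P CoxeterMatrix.H₃

/-- Type `H₄`. -/
def IsTypeH₄ (P : RootPairing ι ℝ V₀ V₀') : Prop := HasCoxeterType P CoxeterMatrix.H₄

/-- The reflection group `W`, acting on the coroot space `V₀'`: the group generated by the
reflections `v' ↦ v' - (α, v') α^∨`. -/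
def reflectionGroup (P : RootPairing ι ℝ V₀ V₀') : Subgroup (V₀' ≃ₗ[ℝ] V₀') :=
  Subgroup.closure (Set.range P.coreflection)

end RootSystems

/-! ### The Clifford algebra, the Pin group and the double cover -/

section Clifford

variable (E : Type*) [NormedAddCommGroup E] [InnerProductSpace ℝ E]

/-- The quadratic form `v ↦ -⟨v, v⟩`. -/
def negForm : QuadraticForm ℝ E := -(LinearMap.BilinMap.toQuadraticMap (innerₗ E))

lemma negForm_apply (v : E) : negForm E v = -(inner ℝ v v) := by
  simp [negForm]

/-- The real Clifford algebra `C(E)`, with the relations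
`v * w + w * v = -2 ⟨v, w⟩`. -/
abbrev Cl : Type _ := CliffordAlgebra (negForm E)

/-- The complex Clifford algebra of `ℂ ⊗ E`, with the complex bilinear extension of the form. -/
abbrev ClC : Type _ := CliffordAlgebra ((negForm E).baseChange ℂ)

/-- The embedding of the real Clifford algebra into the complex one; on vectors `v ↦ 1 ⊗ v`. -/
abbrev toClC : Cl E →ₐ[ℝ] ClC E := CliffordAlgebra.ofBaseChangeAux ℂ (negForm E)

lemma ι_injective : Function.Injective (CliffordAlgebra.ι (negForm E)) := by
  rw [injective_iff_map_eq_zero]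
  intro v hv
  have h := CliffordAlgebra.ι_sq_scalar (negForm E) v
  rw [hv, zero_mul] at h
  have h0 : negForm E v = 0 :=
    (map_eq_zero_iff _ (algebraMap ℝ (Cl E)).injective).mp h.symm
  rw [negForm_apply, neg_eq_zero] at h0
  exact inner_self_eq_zero.mp h0

variable {E}

/-- `a` acts on vectors by `g`: `ε(a) v a⁻¹ = g v` for all `v`, where `ε` is the automorphism of
the Clifford algebra that is `-1` on vectors. -/
def ActsBy (a : (Cl E)ˣ) (g : E ≃ₗ[ℝ] E) : Prop :=
  ∀ v : E, CliffordAlgebra.involute (a : Cl E) * CliffordAlgebra.ι (negForm E) v *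
    ((a⁻¹ : (Cl E)ˣ) : Cl E) = CliffordAlgebra.ι (negForm E) (g v)

lemma ActsBy.one : ActsBy (1 : (Cl E)ˣ) 1 := by
  intro v; simp

lemma ActsBy.mul {a b : (Cl E)ˣ} {g h : E ≃ₗ[ℝ] E} (ha : ActsBy a g) (hb : ActsBy b h) :
    ActsBy (a * b) (g * h) := by
  intro v
  have h1 := hb v
  have h2 := ha (h v)
  rw [← h1] at h2
  rw [LinearEquiv.mul_apply, ← h2]
  simp [mul_assoc]

lemma ActsBy.inv {a : (Cl E)ˣ} {g : E ≃ₗ[ℝ] E} (ha : ActsBy a g) : ActsBy a⁻¹ g⁻¹ := by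
  intro v
  have h := ha (g⁻¹ v)
  have hg : g (g⁻¹ v) = v := g.apply_symm_apply v
  rw [hg] at h
  have hi : CliffordAlgebra.involute ((a⁻¹ : (Cl E)ˣ) : Cl E) *
      CliffordAlgebra.involute (a : Cl E) = 1 := by
    rw [← map_mul, Units.inv_mul, map_one]
  rw [← h, inv_inv]
  calc _ = (CliffordAlgebra.involute ((a⁻¹ : (Cl E)ˣ) : Cl E) *
        CliffordAlgebra.involute (a : Cl E)) * CliffordAlgebra.ι (negForm E) (g⁻¹ v) *
        (((a⁻¹ : (Cl E)ˣ) : Cl E) * (a : Cl E)) := by simp only [mul_assoc]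
    _ = _ := by rw [hi, Units.inv_mul, one_mul, mul_one]

lemma ActsBy.unique {a : (Cl E)ˣ} {g h : E ≃ₗ[ℝ] E} (hg : ActsBy a g) (hh : ActsBy a h) :
    g = h :=
  LinearEquiv.ext fun v => ι_injective E ((hg v).symm.trans (hh v))

variable (E)

/-- The group `Pin(E)` of the units `a` of `C(E)` with `aᵗ = a⁻¹` and `ε(a) E a⁻¹ ⊆ E`. Here `ᵗ` is
the anti-automorphism that is `-1` on vectors, which is `star` in Mathlib. As
`v ↦ ε(a) v a⁻¹` is injective, for finite-dimensional `E` the second condition says that it is an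
automorphism of `E`. -/
def Pin : Subgroup (Cl E)ˣ where
  carrier := {a | star (a : Cl E) = ((a⁻¹ : (Cl E)ˣ) : Cl E) ∧ ∃ g : E ≃ₗ[ℝ] E, ActsBy a g}
  one_mem' := ⟨by simp, 1, ActsBy.one⟩
  mul_mem' := by
    rintro a b ⟨ha, g, hg⟩ ⟨hb, h, hh⟩
    exact ⟨by simp [ha, hb], g * h, hg.mul hh⟩
  inv_mem' := by
    rintro a ⟨ha, g, hg⟩
    exact ⟨by rw [← ha, star_star, inv_inv], g⁻¹, hg.inv⟩

/-- The homomorphism `p` from `Pin(E)`, `p(a) v = ε(a) v a⁻¹`. -/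
def pinHom : Pin E →* (E ≃ₗ[ℝ] E) where
  toFun a := a.2.2.choose
  map_one' := ActsBy.unique (1 : Pin E).2.2.choose_spec ActsBy.one
  map_mul' a b := ActsBy.unique (a * b).2.2.choose_spec
    (a.2.2.choose_spec.mul b.2.2.choose_spec)

lemma pinHom_spec (a : Pin E) : ActsBy (a : (Cl E)ˣ) (pinHom E a) := a.2.2.choose_spec

variable {E}

/-- The double cover `p⁻¹(W)` of a group `W` of linear transformations of `E`. -/
abbrev cover (W : Subgroup (E ≃ₗ[ℝ] E)) : Subgroup (Pin E) := W.comap (pinHom E)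

/-- The projection `p : p⁻¹(W) → W`. -/
abbrev coverMap (W : Subgroup (E ≃ₗ[ℝ] E)) : cover W →* W := (pinHom E).subgroupComap W

/-- The representation of `p⁻¹(W)` on a module `S` over the complex Clifford algebra. -/
def spinRep (W : Subgroup (E ≃ₗ[ℝ] E)) (S : Type) [AddCommGroup S] [Module ℂ S]
    [Module (ClC E) S] [IsScalarTower ℂ (ClC E) S] : Representation ℂ (cover W) S where
  toFun a := Algebra.lsmul ℂ ℂ S (toClC E (((a : Pin E) : (Cl E)ˣ) : Cl E))
  map_one' := by simp
  map_mul' a b := by simp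

end Clifford

/-! ### Representation rings -/

section RepRing

variable (G : Type*) [Group G]

/-- The relations `[X] = [Y] + [Z]` whenever `X ≅ Y ⊕ Z`. -/
def repRel : Submodule ℂ (FDRep ℂ G →₀ ℂ) :=
  Submodule.span ℂ {x | ∃ X Y Z : FDRep ℂ G, Nonempty (X ≅ Y ⊞ Z) ∧
    x = Finsupp.single X 1 - Finsupp.single Y 1 - Finsupp.single Z 1}

/-- The representation ring `R(G)` of a finite group `G`, with complex coefficients (as a complex
vector space): generated by the finite-dimensional complex representations of `G`, with the
relations `[Y ⊕ Z] = [Y] + [Z]`. -/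
abbrev RepRing : Type _ := (FDRep ℂ G →₀ ℂ) ⧸ repRel G

variable {G}

/-- The class of a representation. -/
def repClass (X : FDRep ℂ G) : RepRing G := (repRel G).mkQ (Finsupp.single X 1)

/-- The linear map of representation rings given by a functor that preserves direct sums. -/
def RepRing.map {H : Type*} [Group H] (F : FDRep ℂ G ⥤ FDRep ℂ H) [F.Additive] :
    RepRing G →ₗ[ℂ] RepRing H :=
  (repRel G).mapQ (repRel H) (Finsupp.lmapDomain ℂ ℂ F.obj) <| by
    rw [repRel, Submodule.span_le]
    rintro _ ⟨X, Y, Z, ⟨e⟩, rfl⟩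
    have := Functor.preservesFiniteBiproductsOfAdditive F
    have := preservesBinaryBiproduct_of_preservesBiproduct F Y Z
    refine Submodule.subset_span ⟨F.obj X, F.obj Y, F.obj Z,
      ⟨F.mapIso e ≪≫ F.mapBiprod Y Z⟩, ?_⟩
    simp only [map_sub, Finsupp.lmapDomain_apply, Finsupp.mapDomain_single]

lemma RepRing.map_repClass {H : Type*} [Group H] (F : FDRep ℂ G ⥤ FDRep ℂ H) [F.Additive]
    (X : FDRep ℂ G) : RepRing.map F (repClass X) = repClass (F.obj X) := by
  simp [RepRing.map, repClass, Finsupp.lmapDomain_apply, Finsupp.mapDomain_single]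

/-- A representation of the cover `p : G → H` is genuine if it does not factor through `p`. -/
def IsGenuine {H : Type*} [Group H] (p : G →* H) (X : FDRep ℂ G) : Prop :=
  ¬ ∀ g : G, p g = 1 → X.ρ g = 1

/-- The subspace of `R(G)` spanned by the genuine irreducible representations. -/
def genuinePart {H : Type*} [Group H] (p : G →* H) : Submodule ℂ (RepRing G) :=
  Submodule.span ℂ {x | ∃ X : FDRep ℂ G, Simple X ∧ IsGenuine p X ∧ x = repClass X}

/-- The linear map `R(H) → R(G)`, `σ ↦ p^*σ ⊗ T`, for a homomorphism `p : G → H` and a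
representation `T` of `G`. -/
def tensorMap {H : Type*} [Group H] (p : G →* H) (T : FDRep ℂ G) :
    RepRing H →ₗ[ℂ] RepRing G :=
  RepRing.map (Action.res (FGModuleCat ℂ) p ⋙ tensorRight T)

lemma tensorMap_repClass {H : Type*} [Group H] (p : G →* H) (T : FDRep ℂ G) (X : FDRep ℂ H) :
    tensorMap p T (repClass X) = repClass ((Action.res (FGModuleCat ℂ) p).obj X ⊗ T) :=
  RepRing.map_repClass _ X

end RepRing

section SpinMap

variable {E : Type*} [NormedAddCommGroup E] [InnerProductSpace ℝ E]

/-- The map `i_S : R(W) → R(W̃)`, `σ ↦ σ ⊗ S`. -/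
def spinMap (W : Subgroup (E ≃ₗ[ℝ] E)) (S : Type) [AddCommGroup S] [Module ℂ S]
    [Module (ClC E) S] [IsScalarTower ℂ (ClC E) S] [Module.Finite ℂ S] :
    RepRing W →ₗ[ℂ] RepRing (cover W) :=
  tensorMap (coverMap W) (FDRep.of (spinRep W S))

end SpinMap

end SpinCover

end

/-! Write `z` for the element -1 of the double cover. Taking characters identifies the
representation ring with the class functions (`charMap_injective`, `exists_charMap_eq`), genuine
classes have characters that are odd under `z`, and `i_S` becomes multiplication by the character of
`S`. Hence `i_S` is onto exactly when every `g` at which the character of `S` vanishes is conjugate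
to `z * g`. Such conjugacy forces all genuine characters to vanish at `g`, so one can divide
(`exists_tensorMap_eq`). Without it, some genuine irreducible character is nonzero at `g`
(`exists_notMem_range_tensorMap`).

In all surjective cases -1 lies in `W`, and this disposes of the odd elements
(`clTrace_ne_zero_or_conj`). A lift `ω` of -1 anticommutes with odd elements if it is even. If it is
odd, it is central, acts on `S` by a scalar, and multiplication by it makes an odd element even. For
an even `g`, it suffices that `g` negates some root `β`: then conjugation by `β` takes `g` to `-g`.

Even elements are handled by quaternions. An isometric map `θ` from the coroot space to the
quaternions turns `g` into a pair `(a, b)` with `a * θ v = θ (g v) * b`, and the trace of `g` on `S`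
is proportional to `re a + re b`, because a trace on even Clifford products is determined by its
value at 1 (`clTrace_mul_eq`). So `re a + re b = 0` has to produce a root `β` with `a * θ β = -(θ β
* b)` (`exists_spinMap_eq`). For `H₄`, `a` and `b` are unit icosians, and so are the roots; unit
icosians with equal real parts are conjugate by a unit icosian, which applies to `a` and `-b`. For
`H₃`, the roots are the pure unit icosians and `a = b`; a root orthogonal to the pure quaternion `a`
anticommutes with it. For `I₂(n)`, everything lies in a copy of the complex numbers and `b` is the
conjugate of `a`, so `a` is imaginary and every root works.

For `I₂(n)` with `n` odd, let `g` lift a reflection. Its trace is zero. If it were conjugate to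
`-g`, some rotation in `W` would negate a root, hence would be -1, which is impossible in a cyclic
group of odd order.

The coordinates come from the Coxeter diagram: orders 2, 3, 5 of products of simple reflections
determine the Gram matrix of the unit simple coroots, which matches that of explicit icosians. -/

noncomputable section

namespace SpinCover

/-! ### Characters identify the representation ring with the class functions -/

section RepRingCharacters

variable {G : Type*} [Group G]

/-- The morphism given by an equivariant linear map. -/
def homOf {X Y : FDRep ℂ G} (f : X →ₗ[ℂ] Y) (h : ∀ g v, f (X.ρ g v) = Y.ρ g (f v)) : X ⟶ Y :=
  ⟨InducedCategory.homMk (ModuleCat.ofHom f), fun g => by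
    ext v
    exact h g v⟩

lemma homOf_comp {X Y Z : FDRep ℂ G} (f : X →ₗ[ℂ] Y) (h : ∀ g v, f (X.ρ g v) = Y.ρ g (f v))
    (f' : Y →ₗ[ℂ] Z) (h' : ∀ g v, f' (Y.ρ g v) = Z.ρ g (f' v)) :
    homOf f h ≫ homOf f' h' = homOf (f' ∘ₗ f) (fun g v => by simp [h, h']) := rfl

/-- The underlying linear map of a morphism. -/
def linOf {X Y : FDRep ℂ G} (f : X ⟶ Y) : X →ₗ[ℂ] Y := f.hom.hom.hom

lemma linOf_comm {X Y : FDRep ℂ G} (f : X ⟶ Y) (g : G) (v : X) :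
    linOf f (X.ρ g v) = Y.ρ g (linOf f v) :=
  ConcreteCategory.congr_hom ((forget (FGModuleCat ℂ)).congr_map (f.comm g)) v

lemma linOf_comp {X Y Z : FDRep ℂ G} (f : X ⟶ Y) (f' : Y ⟶ Z) :
    linOf (f ≫ f') = linOf f' ∘ₗ linOf f := rfl

lemma linOf_id (X : FDRep ℂ G) : linOf (𝟙 X) = LinearMap.id := rfl

lemma linOf_add {X Y : FDRep ℂ G} (f f' : X ⟶ Y) : linOf (f + f') = linOf f + linOf f' := rfl

lemma linOf_zero {X Y : FDRep ℂ G} : linOf (0 : X ⟶ Y) = 0 := rfl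

lemma linOf_homOf {X Y : FDRep ℂ G} (f : X →ₗ[ℂ] Y) (h : ∀ g v, f (X.ρ g v) = Y.ρ g (f v)) :
    linOf (homOf f h) = f := rfl

lemma linOf_injective {X Y : FDRep ℂ G} : Function.Injective (linOf : (X ⟶ Y) → _) := by
  intro f g h
  have : homOf (linOf f) (linOf_comm f) = homOf (linOf g) (linOf_comm g) := by
    congr 1
  exact this

/-- The isomorphism given by an equivariant linear equivalence. -/
def isoOf {X Y : FDRep ℂ G} (f : X ≃ₗ[ℂ] Y) (h : ∀ g v, f (X.ρ g v) = Y.ρ g (f v)) : X ≅ Y where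
  hom := homOf f h
  inv := homOf f.symm (fun g v => by rw [LinearEquiv.coe_coe, LinearEquiv.symm_apply_eq, h]; simp)
  hom_inv_id := by
    rw [homOf_comp]; apply linOf_injective; rw [linOf_homOf, linOf_id]; ext; simp
  inv_hom_id := by
    rw [homOf_comp]; apply linOf_injective; rw [linOf_homOf, linOf_id]; ext; simp

lemma repClass_eq_add {X Y Z : FDRep ℂ G} (e : X ≅ Y ⊞ Z) :
    repClass X = repClass Y + repClass Z := by
  rw [← sub_eq_zero, ← sub_sub]
  simp only [repClass, ← map_sub]
  rw [Submodule.mkQ_apply, Submodule.Quotient.mk_eq_zero]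
  exact Submodule.subset_span ⟨X, Y, Z, ⟨e⟩, rfl⟩

/-- The action on the sum is the sum of the actions on `Y` and `Z` conjugated by inclusions and
projections; cyclicity of the trace cancels these maps. -/
lemma char_biprod {X Y Z : FDRep ℂ G} (e : X ≅ Y ⊞ Z) (g : G) :
    X.character g = Y.character g + Z.character g := by
  rw [FDRep.char_iso e]
  simp only [FDRep.character]
  have h : (Y ⊞ Z).ρ g = linOf biprod.inl ∘ₗ (Y.ρ g ∘ₗ linOf biprod.fst) +
      linOf biprod.inr ∘ₗ (Z.ρ g ∘ₗ linOf biprod.snd) := by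
    ext v
    have h1 : linOf (biprod.fst ≫ biprod.inl + biprod.snd ≫ biprod.inr : Y ⊞ Z ⟶ Y ⊞ Z) =
      linOf (𝟙 _) := by rw [biprod.total]
    have h2 := LinearMap.congr_fun h1 ((Y ⊞ Z).ρ g v)
    rw [linOf_add, linOf_comp, linOf_comp, linOf_id] at h2
    simp only [LinearMap.add_apply, LinearMap.comp_apply, LinearMap.id_apply] at h2 ⊢
    rw [← linOf_comm, ← linOf_comm, h2]
  have hf : linOf (biprod.fst : Y ⊞ Z ⟶ Y) ∘ₗ linOf biprod.inl = LinearMap.id := by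
    rw [← linOf_comp, biprod.inl_fst, linOf_id]
  have hs : linOf (biprod.snd : Y ⊞ Z ⟶ Z) ∘ₗ linOf biprod.inr = LinearMap.id := by
    rw [← linOf_comp, biprod.inr_snd, linOf_id]
  rw [h, map_add, LinearMap.trace_comp_comm', LinearMap.comp_assoc, hf, LinearMap.comp_id,
    LinearMap.trace_comp_comm', LinearMap.comp_assoc, hs, LinearMap.comp_id]

variable (G) in
/-- The character map on the representation ring. -/
def charMap : RepRing G →ₗ[ℂ] (G → ℂ) :=
  (repRel G).liftQ (Finsupp.lift (G → ℂ) ℂ (FDRep ℂ G) FDRep.character) <| by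
    rw [repRel, Submodule.span_le]
    rintro _ ⟨X, Y, Z, ⟨e⟩, rfl⟩
    rw [SetLike.mem_coe, LinearMap.mem_ker, map_sub, map_sub]
    ext g
    simp [char_biprod e g]

@[simp]
lemma charMap_repClass (X : FDRep ℂ G) : charMap G (repClass X) = X.character := by
  simp [charMap, repClass]

lemma span_repClass : Submodule.span ℂ (Set.range (repClass (G := G))) = ⊤ := by
  rw [eq_top_iff]
  rintro x -
  obtain ⟨x, rfl⟩ := (repRel G).mkQ_surjective x
  induction x using Finsupp.induction_linear with
  | zero => simp
  | add f g hf hg => rw [map_add]; exact add_mem hf hg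
  | single X c =>
    have : Finsupp.single X c = c • Finsupp.single X (1 : ℂ) := by simp
    rw [this, map_smul]
    exact Submodule.smul_mem _ _ (Submodule.subset_span ⟨X, rfl⟩)

lemma mem_span_repClass (x : RepRing G) :
    x ∈ Submodule.span ℂ (Set.range (repClass (G := G))) := by
  rw [span_repClass]
  trivial

open Representation in
lemma simple_of_isIrreducible (X : FDRep ℂ G) (hX : IsIrreducible X.ρ) : Simple X where
  mono_isIso_iff_nonzero {Y} f hf := by
    have hfin : Function.Injective (linOf f) := by
      have : Mono f.hom := inferInstanceAs (Mono ((Action.forget (FGModuleCat ℂ) G).map f))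
      have h2 : Mono ((forget₂ (FGModuleCat ℂ) (ModuleCat ℂ)).map f.hom) := inferInstance
      exact (ModuleCat.mono_iff_injective _).mp h2
    constructor
    · rintro hiso rfl
      have h := congrArg linOf (IsIso.inv_hom_id (0 : Y ⟶ X))
      rw [comp_zero, linOf_zero, linOf_id] at h
      have : Subsingleton X := ⟨fun a b => by
        rw [← LinearMap.id_apply (R := ℂ) a, ← LinearMap.id_apply (R := ℂ) b, ← h]; rfl⟩
      apply hX.toNontrivial.exists_pair_ne.elim
      rintro p ⟨q, hpq⟩
      exact hpq (SetLike.ext fun x => by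
        rw [Subsingleton.elim x 0]
        exact ⟨fun _ => q.toSubmodule.zero_mem, fun _ => p.toSubmodule.zero_mem⟩)
    · intro hne
      let R : Subrepresentation X.ρ := ⟨LinearMap.range (linOf f), by
        rintro g _ ⟨y, rfl⟩
        exact ⟨Y.ρ g y, linOf_comm f g y⟩⟩
      have hsurj : Function.Surjective (linOf f) := by
        rcases eq_bot_or_eq_top R with h | h
        · exfalso
          apply hne
          apply linOf_injective
          ext y
          have : linOf f y ∈ R := ⟨y, rfl⟩
          rw [h] at this
          exact this
        · intro x
          have : x ∈ R := by rw [h]; trivial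
          exact this
      let e := isoOf (X := Y) (Y := X) (LinearEquiv.ofBijective (linOf f) ⟨hfin, hsurj⟩)
        (linOf_comm f)
      have : f = e.hom := linOf_injective rfl
      rw [this]
      infer_instance

/-- An equivariant linear equivalence with a product gives an isomorphism with the biproduct. -/
def isoBiprodOf {X Y Z : FDRep ℂ G} (e : (Y × Z) ≃ₗ[ℂ] X)
    (he : ∀ g a b, e (Y.ρ g a, Z.ρ g b) = X.ρ g (e (a, b))) : X ≅ Y ⊞ Z := by
  have hs : ∀ g v, e.symm (X.ρ g v) = (Y.ρ g (e.symm v).1, Z.ρ g (e.symm v).2) := fun g v => by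
    rw [LinearEquiv.symm_apply_eq, he]; simp
  let i₁ : Y ⟶ X := homOf (e.toLinearMap ∘ₗ LinearMap.inl ℂ Y Z) (fun g v => by
    simpa using he g v 0)
  let i₂ : Z ⟶ X := homOf (e.toLinearMap ∘ₗ LinearMap.inr ℂ Y Z) (fun g v => by
    simpa using he g 0 v)
  let p₁ : X ⟶ Y := homOf (LinearMap.fst ℂ Y Z ∘ₗ e.symm.toLinearMap) (fun g v => by simp [hs])
  let p₂ : X ⟶ Z := homOf (LinearMap.snd ℂ Y Z ∘ₗ e.symm.toLinearMap) (fun g v => by simp [hs])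
  have h11 : i₁ ≫ p₁ = 𝟙 Y := linOf_injective <| LinearMap.ext fun v =>
    congrArg Prod.fst (e.symm_apply_apply (v, 0))
  have h12 : i₁ ≫ p₂ = 0 := linOf_injective <| LinearMap.ext fun v =>
    congrArg Prod.snd (e.symm_apply_apply (v, 0))
  have h21 : i₂ ≫ p₁ = 0 := linOf_injective <| LinearMap.ext fun v =>
    congrArg Prod.fst (e.symm_apply_apply (0, v))
  have h22 : i₂ ≫ p₂ = 𝟙 Z := linOf_injective <| LinearMap.ext fun v =>
    congrArg Prod.snd (e.symm_apply_apply (0, v))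
  have ht : p₁ ≫ i₁ + p₂ ≫ i₂ = 𝟙 X := linOf_injective <| LinearMap.ext fun v => by
    change e ((e.symm v).1, 0) + e (0, (e.symm v).2) = v
    rw [← map_add]
    simp
  exact
    { hom := biprod.lift p₁ p₂
      inv := biprod.desc i₁ i₂
      hom_inv_id := by rw [biprod.lift_desc, ht]
      inv_hom_id := by
        apply biprod.hom_ext' <;> apply biprod.hom_ext <;> simp [h11, h12, h21, h22] }

open Representation in
lemma exists_biprod_of_not_isIrreducible [Finite G] (X : FDRep ℂ G) [Nontrivial X]
    (hX : ¬ IsIrreducible X.ρ) : ∃ Y Z : FDRep ℂ G, Nonempty (X ≅ Y ⊞ Z) ∧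
      Module.finrank ℂ Y < Module.finrank ℂ X ∧ Module.finrank ℂ Z < Module.finrank ℂ X := by
  have hss : IsSemisimpleRepresentation X.ρ := inferInstance
  have hnt : Nontrivial (Subrepresentation X.ρ) := by
    obtain ⟨x, hx⟩ := exists_ne (0 : X)
    refine ⟨⊥, ⊤, fun h => hx ?_⟩
    have : x ∈ (⊤ : Subrepresentation X.ρ) := trivial
    rw [← h] at this
    exact this
  obtain ⟨A, hA⟩ : ∃ A : Subrepresentation X.ρ, A ≠ ⊥ ∧ A ≠ ⊤ := by
    by_contra! h
    exact hX ⟨fun A => or_iff_not_imp_left.mpr (h A)⟩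
  obtain ⟨B, hAB⟩ := hss.exists_isCompl A
  have hc : IsCompl A.toSubmodule B.toSubmodule := by
    constructor
    · rw [disjoint_iff]
      have := hAB.1.eq_bot
      exact congrArg Subrepresentation.toSubmodule this
    · rw [codisjoint_iff]
      have := hAB.2.eq_top
      exact congrArg Subrepresentation.toSubmodule this
  have hAt : A.toSubmodule ≠ ⊤ := fun h => hA.2 (Subrepresentation.toSubmodule_injective h)
  have hBt : B.toSubmodule ≠ ⊤ := fun h => hA.1 (Subrepresentation.toSubmodule_injective (by
    have := hc.inf_eq_bot
    rw [h, inf_top_eq] at this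
    exact this))
  exact ⟨FDRep.of A.toRepresentation, FDRep.of B.toRepresentation,
    ⟨isoBiprodOf (Submodule.prodEquivOfIsCompl _ _ hc) fun g a b => (map_add (X.ρ g) _ _).symm⟩,
    Submodule.finrank_lt hAt, Submodule.finrank_lt hBt⟩

/-- The zero representation is isomorphic to two copies of itself, so its class `c` satisfies `c = c
+ c`. -/
lemma repClass_eq_zero (X : FDRep ℂ G) [Subsingleton X] : repClass X = 0 := by
  have e : X ≅ X ⊞ X := isoBiprodOf
    { toFun := 0, invFun := 0, map_add' := by simp, map_smul' := by simp,
      left_inv := fun _ => Subsingleton.elim _ _, right_inv := fun _ => Subsingleton.elim _ _ }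
    fun _ _ _ => Subsingleton.elim _ _
  simpa using repClass_eq_add e

/-- The class of a representation is in the span of the classes of its simple constituents. -/
lemma repClass_mem_span [Finite G] (Q : FDRep ℂ G → Prop)
    (hQ : ∀ X Y Z : FDRep ℂ G, Nonempty (X ≅ Y ⊞ Z) → Q X → Q Y ∧ Q Z) (X : FDRep ℂ G) (hX : Q X) :
    repClass X ∈ Submodule.span ℂ {x | ∃ Y : FDRep ℂ G, Simple Y ∧ Q Y ∧ x = repClass Y} := by
  induction h : Module.finrank ℂ X using Nat.strong_induction_on generalizing X with
  | _ n ih =>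
  rcases subsingleton_or_nontrivial X with hs | hn
  · rw [repClass_eq_zero]; exact zero_mem _
  by_cases hi : Representation.IsIrreducible X.ρ
  · exact Submodule.subset_span ⟨X, simple_of_isIrreducible X hi, hX, rfl⟩
  · obtain ⟨Y, Z, ⟨e⟩, hY, hZ⟩ := exists_biprod_of_not_isIrreducible X hi
    have hq := hQ X Y Z ⟨e⟩ hX
    rw [repClass_eq_add e]
    exact add_mem (ih _ (h ▸ hY) Y hq.1 rfl) (ih _ (h ▸ hZ) Z hq.2 rfl)

/-- The defining relations only speak of direct sums, so both `X` and `Y` are compared with `Y ⊞ 0`.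
-/
lemma repClass_eq_of_iso {X Y : FDRep ℂ G} (e : X ≅ Y) : repClass X = repClass Y := by
  let Z : FDRep ℂ G := FDRep.of (Representation.trivial ℂ G PUnit)
  have : Subsingleton Z := inferInstanceAs (Subsingleton PUnit)
  have e' : Y ≅ Y ⊞ Z := isoBiprodOf
    { toFun := fun p => p.1, invFun := fun y => (y, 0), map_add' := by simp, map_smul' := by simp,
      left_inv := fun _ => Prod.ext rfl (Subsingleton.elim _ _), right_inv := fun _ => rfl }
    fun _ _ _ => rfl
  rw [repClass_eq_add e', repClass_eq_add (e ≪≫ e')]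

/-- Representatives of the simple isomorphism classes span, and orthonormality of their characters
recovers each coefficient. -/
lemma charMap_injective [Finite G] : Function.Injective (charMap G) := by
  classical
  have := Fintype.ofFinite G
  have hinv : Invertible (Nat.card G : ℂ) := invertibleOfNonzero (by simp)
  let T := {X : FDRep ℂ G // Simple X}
  let st : Setoid T := ⟨fun X Y => Nonempty (X.1 ≅ Y.1), fun X => ⟨Iso.refl _⟩,
    fun ⟨e⟩ => ⟨e.symm⟩, fun ⟨e⟩ ⟨e'⟩ => ⟨e ≪≫ e'⟩⟩
  let v : Quotient st → RepRing G := fun q => repClass q.out.1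
  have hspan : Submodule.span ℂ (Set.range v) = ⊤ := by
    rw [eq_top_iff, ← span_repClass, Submodule.span_le]
    rintro _ ⟨X, rfl⟩
    have h := repClass_mem_span (fun _ => True) (fun _ _ _ _ _ => ⟨trivial, trivial⟩) X trivial
    refine Submodule.span_mono ?_ h
    rintro _ ⟨Y, hY, -, rfl⟩
    refine ⟨Quotient.mk st ⟨Y, hY⟩, ?_⟩
    obtain ⟨e⟩ := Quotient.mk_out (s := st) (⟨Y, hY⟩ : T)
    exact repClass_eq_of_iso e
  rw [injective_iff_map_eq_zero]
  intro x hx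
  have hmem : x ∈ Submodule.span ℂ (Set.range v) := hspan ▸ Submodule.mem_top
  obtain ⟨l, rfl⟩ := (Finsupp.mem_span_range_iff_exists_finsupp).mp hmem
  suffices l = 0 by simp [this]
  ext q
  have h1 : (Nat.card G : ℂ)⁻¹ * ∑ g : G, (charMap G (l.sum fun i a => a • v i)) g *
      q.out.1.character g⁻¹ = l q := by
    have hs : ∀ i : Quotient st, (Nat.card G : ℂ)⁻¹ * ∑ g : G, i.out.1.character g *
        q.out.1.character g⁻¹ = if i = q then 1 else 0 := by
      intro i
      have := i.out.2
      have := q.out.2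
      rw [FDRep.char_orthonormal]
      congr 1
      rw [← Quotient.out_equiv_out]
      rfl
    calc _ = l.sum fun i a => a * ((Nat.card G : ℂ)⁻¹ * ∑ g : G, i.out.1.character g *
        q.out.1.character g⁻¹) := by
          simp only [Finsupp.sum, map_sum, map_smul, v, charMap_repClass, Finset.sum_apply,
            Pi.smul_apply, smul_eq_mul, Finset.sum_mul, Finset.mul_sum]
          rw [Finset.sum_comm]
          refine Finset.sum_congr rfl fun _ _ => Finset.sum_congr rfl fun _ _ => by ring
      _ = _ := by
          simp only [hs]
          simpa [Finsupp.sum] using Eq.symm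
  rw [hx] at h1
  rw [← h1]; simp

/-- On a simple `X` the operator commutes with the group, so Schur's lemma makes it a scalar, and
its trace is zero by `h0`. The general case splits `X` into smaller summands. -/
lemma sum_smul_rho_eq_zero [Finite G] [Fintype G] (f : G → ℂ) (hf : ∀ g h, f (h * g * h⁻¹) = f g)
    (h0 : ∀ X : FDRep ℂ G, ∑ g, f g * X.character g = 0) (X : FDRep ℂ G) :
    ∑ g, f g • X.ρ g = 0 := by
  induction h : Module.finrank ℂ X using Nat.strong_induction_on generalizing X with
  | _ n ih =>
  rcases subsingleton_or_nontrivial X with hs | hn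
  · ext v; exact Subsingleton.elim _ _
  by_cases hi : Representation.IsIrreducible X.ρ
  · have := simple_of_isIrreducible X hi
    let F : X ⟶ X := homOf (∑ g, f g • X.ρ g) fun k v => by
      simp only [LinearMap.sum_apply, LinearMap.smul_apply, map_sum, map_smul,
        ← Module.End.mul_apply, ← map_mul]
      rw [← Equiv.sum_comp (MulAut.conj k).toEquiv]
      refine Finset.sum_congr rfl fun g _ => ?_
      simp [hf]
    obtain ⟨c, hc⟩ := endomorphism_simple_eq_smul_id ℂ F
    have hc' : c • LinearMap.id = ∑ g, f g • X.ρ g := congrArg linOf hc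
    have ht : c * Module.finrank ℂ X = 0 := by
      have := congrArg (LinearMap.trace ℂ X) hc'
      rw [map_smul, LinearMap.trace_id, map_sum] at this
      rw [← smul_eq_mul, this, ← h0 X]
      exact Finset.sum_congr rfl fun g _ => by rw [map_smul]; rfl
    have : c = 0 := by
      have h2 : Module.finrank ℂ X ≠ 0 := Module.finrank_pos.ne'
      simpa [h2] using ht
    rw [← hc', this, zero_smul]
  · obtain ⟨Y, Z, ⟨e⟩, hY, hZ⟩ := exists_biprod_of_not_isIrreducible X hi
    have h1 := ih _ (h ▸ hY) Y rfl
    have h2 := ih _ (h ▸ hZ) Z rfl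
    have key : ∀ (W : FDRep ℂ G) (p : X ⟶ W), ∑ g, f g • W.ρ g = 0 →
        ∀ v, linOf p ((∑ g, f g • X.ρ g) v) = 0 := fun W p hW v => by
      have h3 := LinearMap.congr_fun hW (linOf p v)
      simp only [LinearMap.sum_apply, LinearMap.smul_apply, map_sum, map_smul, linOf_comm] at h3 ⊢
      exact h3
    ext v
    have ht : 𝟙 X = (e.hom ≫ biprod.fst) ≫ (biprod.inl ≫ e.inv) +
        (e.hom ≫ biprod.snd) ≫ (biprod.inr ≫ e.inv) := by
      have h5 : e.hom ≫ (biprod.fst ≫ biprod.inl + biprod.snd ≫ biprod.inr) ≫ e.inv = 𝟙 X := by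
        rw [biprod.total, Category.id_comp, e.hom_inv_id]
      rw [← h5]
      simp only [Preadditive.add_comp, Preadditive.comp_add, Category.assoc]
    have h4 := LinearMap.congr_fun (congrArg linOf ht) ((∑ g, f g • X.ρ g) v)
    rw [linOf_id, linOf_add, linOf_comp (e.hom ≫ biprod.fst), linOf_comp (e.hom ≫ biprod.snd),
      LinearMap.add_apply, LinearMap.comp_apply, LinearMap.comp_apply, key _ _ h1, key _ _ h2] at h4
    simpa using h4

/-- The regular representation, on functions on `Fin (Nat.card G)`. -/
def regularRep [Finite G] : FDRep ℂ G :=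
  -- Relabelling by `Fin` keeps the space in `Type`, whatever the universe of `G`.
  FDRep.of (V := Fin (Nat.card G) → ℂ)
    { toFun := fun g => LinearMap.funLeft ℂ ℂ fun x => Finite.equivFin G (g⁻¹ *
        (Finite.equivFin G).symm x)
      map_one' := by ext; simp
      map_mul' := fun g h => by ext; simp [mul_assoc] }

lemma eq_zero_of_forall_sum_character [Finite G] [Fintype G] (f : G → ℂ)
    (hf : ∀ g h, f (h * g * h⁻¹) = f g)
    (h0 : ∀ X : FDRep ℂ G, ∑ g, f g * X.character g = 0) : f = 0 := by
  classical
  have h := sum_smul_rho_eq_zero f hf h0 regularRep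
  ext k
  let d : Fin (Nat.card G) → ℂ := Pi.single (Finite.equivFin G 1) 1
  have h1 := congrFun (LinearMap.congr_fun h d) (Finite.equivFin G k)
  have h2 : ∀ g : G, (regularRep.ρ g : (Fin (Nat.card G) → ℂ) →ₗ[ℂ] _) d (Finite.equivFin G k) =
      if g = k then 1 else 0 := fun g => by
    change d (Finite.equivFin G (g⁻¹ * (Finite.equivFin G).symm (Finite.equivFin G k))) = _
    simp [d, Pi.single_apply, inv_mul_eq_one]
  have h3 : ∑ g, f g * (regularRep.ρ g :
      (Fin (Nat.card G) → ℂ) →ₗ[ℂ] _) d (Finite.equivFin G k) = 0 := by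
    refine Eq.trans ?_ h1
    erw [LinearMap.sum_apply, Finset.sum_apply]
    rfl
  simpa [h2] using h3

/-- The characters span the class functions. -/
lemma exists_charMap_eq [Finite G] (f : G → ℂ) (hf : ∀ g h, f (h * g * h⁻¹) = f g) :
    ∃ x, charMap G x = f := by
  classical
  have := Fintype.ofFinite G
  by_contra hne
  have hmem : f ∉ LinearMap.range (charMap G) := fun ⟨x, hx⟩ => hne ⟨x, hx⟩
  -- A functional `φ` that kills all characters but not `f`. Averaging its coefficients over
  -- conjugation gives a class function orthogonal to all characters, hence zero, although it pairs
  -- with `f` to a nonzero multiple of `φ f`.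
  obtain ⟨φ, hφ0, hφ⟩ := Submodule.exists_le_ker_of_notMem hmem
  have hφs : ∀ x : G → ℂ, φ x = ∑ g, x g * φ (Pi.single g 1) := fun x => by
    conv_lhs => rw [← Finset.univ_sum_single x, map_sum]
    refine Finset.sum_congr rfl fun g _ => ?_
    rw [← smul_eq_mul, ← map_smul, ← Pi.single_smul, smul_eq_mul, mul_one]
  have hinv : ∀ x : G → ℂ, (∀ g h, x (h * g * h⁻¹) = x g) →
      ∑ g, (∑ k, φ (Pi.single (k * g * k⁻¹) 1)) * x g = Nat.card G * φ x := fun x hx => by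
    simp only [Finset.sum_mul]
    rw [Finset.sum_comm]
    have : ∀ k : G, ∑ g, φ (Pi.single (k * g * k⁻¹) 1) * x g = φ x := fun k => by
      rw [hφs, ← Equiv.sum_comp (MulAut.conj k).toEquiv (fun g => x g * φ (Pi.single g 1))]
      exact Finset.sum_congr rfl fun g _ => by simp [hx, mul_comm]
    simp [this]
  have h0 := eq_zero_of_forall_sum_character (fun g => ∑ k, φ (Pi.single (k * g * k⁻¹) 1))
    (fun g h => by
      conv_rhs => rw [← Equiv.sum_comp (Equiv.mulRight h)]
      simp [mul_assoc])
    (fun X => by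
      rw [hinv _ (fun g h => FDRep.char_conj X g h)]
      have : φ X.character = 0 := hφ ⟨repClass X, charMap_repClass X⟩
      rw [this, mul_zero])
  have h1 := hinv f hf
  simp only [congrFun h0, Pi.zero_apply, zero_mul, Finset.sum_const_zero] at h1
  apply hφ0
  simpa using h1.symm

end RepRingCharacters

/-! ### Tensoring into the genuine part: the criterion in terms of characters -/

section GenuineCharacters

variable {G H : Type*} [Group G] [Group H] (p : G →* H) (T : FDRep ℂ G)

lemma charMap_tensorMap (σ : RepRing H) (g : G) :
    charMap G (tensorMap p T σ) g = charMap H σ (p g) * T.character g := by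
  have hσ : σ ∈ Submodule.span ℂ (Set.range (repClass (G := H))) := mem_span_repClass σ
  induction hσ using Submodule.span_induction with
  | mem x hx =>
    obtain ⟨X, rfl⟩ := hx
    rw [tensorMap_repClass, charMap_repClass, charMap_repClass, FDRep.char_tensor]
    rfl
  | zero => simp
  | add x y _ _ hx hy => simp only [map_add, Pi.add_apply, hx, hy, add_mul]
  | smul c x _ hx => simp only [map_smul, Pi.smul_apply, hx, smul_eq_mul, mul_assoc]

lemma rho_eq_neg_one_of_biprod {X Y Z : FDRep ℂ G} (e : X ≅ Y ⊞ Z) {z : G} (h : X.ρ z = -1) :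
    Y.ρ z = -1 ∧ Z.ρ z = -1 := by
  have key : ∀ (W : FDRep ℂ G) (i : W ⟶ X) (q : X ⟶ W), i ≫ q = 𝟙 W → W.ρ z = -1 := by
    intro W i q hiq
    ext v
    have h1 : ∀ w, linOf q (linOf i w) = w := fun w => LinearMap.congr_fun (congrArg linOf hiq) w
    rw [← h1 (W.ρ z v), linOf_comm, h]
    simp [h1]
  exact ⟨key Y (biprod.inl ≫ e.inv) (e.hom ≫ biprod.fst) (by simp),
    key Z (biprod.inr ≫ e.inv) (e.hom ≫ biprod.snd) (by simp)⟩

lemma nontrivial_of_simple (X : FDRep ℂ G) [Simple X] : Nontrivial X := by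
  by_contra h
  rw [not_nontrivial_iff_subsingleton] at h
  exact id_nonzero X (linOf_injective (LinearMap.ext fun v => Subsingleton.elim _ _))

variable {z : G}

/-- The element `z` acts by -1 on the tensor product, hence on each of its simple constituents, and
-1 is not the identity on a nonzero space. -/
lemma tensorMap_mem_genuinePart [Finite G] (hz : p z = 1) (hT : T.ρ z = -1) (σ : RepRing H) :
    tensorMap p T σ ∈ genuinePart p := by
  have hσ : σ ∈ Submodule.span ℂ (Set.range (repClass (G := H))) := mem_span_repClass σ
  induction hσ using Submodule.span_induction with
  | mem x hx =>
    obtain ⟨X, rfl⟩ := hx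
    rw [tensorMap_repClass]
    have hQ : FDRep.ρ (MonoidalCategoryStruct.tensorObj ((Action.res
        (FGModuleCat ℂ) p).obj X) T) z = -1 := by
      have h1 : FDRep.ρ (MonoidalCategoryStruct.tensorObj ((Action.res
          (FGModuleCat ℂ) p).obj X) T) z =
        TensorProduct.map (X.ρ (p z)) (T.ρ z) := rfl
      rw [h1, hz, hT, map_one]
      refine TensorProduct.ext' fun x y => ?_
      rw [TensorProduct.map_tmul]
      exact TensorProduct.tmul_neg x y
    refine Submodule.span_mono ?_ (repClass_mem_span (fun Y => Y.ρ z = -1)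
      (fun X Y Z ⟨e⟩ h => rho_eq_neg_one_of_biprod e h) _ hQ)
    rintro _ ⟨Y, hY, hYz, rfl⟩
    refine ⟨Y, hY, fun h => ?_, rfl⟩
    have := nontrivial_of_simple Y
    have h1 := h z hz
    rw [hYz] at h1
    obtain ⟨v, hv⟩ := exists_ne (0 : Y)
    have h2 : -v = v := LinearMap.congr_fun h1 v
    refine hv ((smul_eq_zero_iff_right (two_ne_zero' ℂ)).mp ?_)
    rw [two_smul]
    nth_rewrite 1 [← h2]
    exact neg_add_cancel v
  | zero => simp
  | add x y _ _ hx hy => rw [map_add]; exact add_mem hx hy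
  | smul c x _ hx => rw [map_smul]; exact Submodule.smul_mem _ _ hx

variable {p}

/-- By Schur's lemma the central element `z` acts by a scalar; its square is 1, and the value 1
would make the representation factor through `p`. -/
lemma IsGenuine.rho_eq_neg_one (hk : ∀ g, p g = 1 → g = 1 ∨ g = z)
    (hc : ∀ g, z * g = g * z) (hzz : z * z = 1) {X : FDRep ℂ G} [Simple X] (hX : IsGenuine p X) :
    X.ρ z = -1 := by
  have hne : X.ρ z ≠ 1 := fun h => hX fun g hg => by
    rcases hk g hg with rfl | rfl
    · exact map_one _
    · exact h
  let F : X ⟶ X := homOf (X.ρ z) fun k v => by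
    rw [← Module.End.mul_apply, ← Module.End.mul_apply, ← map_mul, ← map_mul, hc]
  obtain ⟨c, hc⟩ := endomorphism_simple_eq_smul_id ℂ F
  have hc' : c • LinearMap.id = X.ρ z := congrArg linOf hc
  have hsq : X.ρ z * X.ρ z = 1 := by rw [← map_mul, hzz, map_one]
  have := nontrivial_of_simple X
  obtain ⟨v, hv⟩ := exists_ne (0 : X)
  have h1 : (c * c) • v = (1 : ℂ) • v := by
    have := LinearMap.congr_fun hsq v
    rw [← hc'] at this
    simpa [smul_smul] using this
  rcases mul_self_eq_one_iff.mp (smul_left_injective ℂ hv h1) with h | h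
  · exact absurd (by rw [← hc', h, one_smul]; rfl) hne
  · rw [← hc', h, neg_smul, one_smul]; rfl

lemma charMap_mul_of_mem_genuinePart (hk : ∀ g, p g = 1 → g = 1 ∨ g = z)
    (hc : ∀ g, z * g = g * z) (hzz : z * z = 1) {y : RepRing G} (hy : y ∈ genuinePart p) (g : G) :
    charMap G y (z * g) = -charMap G y g := by
  induction hy using Submodule.span_induction with
  | mem x hx =>
    obtain ⟨X, hX, hXg, rfl⟩ := hx
    simp only [charMap_repClass, FDRep.character, map_mul, hXg.rho_eq_neg_one hk hc hzz, neg_mul,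
        one_mul, map_neg]
  | zero => simp
  | add x y _ _ hx hy => simp only [map_add, Pi.add_apply, hx, hy, neg_add]
  | smul c x _ hx => simp only [map_smul, Pi.smul_apply, hx, smul_neg]

lemma charMap_conj (x : RepRing G) (g h : G) : charMap G x (h * g * h⁻¹) = charMap G x g := by
  have hx : x ∈ Submodule.span ℂ (Set.range (repClass (G := G))) := mem_span_repClass x
  induction hx using Submodule.span_induction with
  | mem x hx =>
    obtain ⟨X, rfl⟩ := hx
    rw [charMap_repClass, FDRep.char_conj]
  | zero => simp
  | add x y _ _ hx hy => simp only [map_add, Pi.add_apply, hx, hy]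
  | smul c x _ hx => simp only [map_smul, Pi.smul_apply, hx]

/-- If the character of `T` vanishes only where all genuine characters do, then tensoring with `T`
is surjective onto the genuine part. -/
lemma exists_tensorMap_eq [Finite G] [Finite H] (hp : Function.Surjective p)
    (hT : T.ρ z = -1) (hk : ∀ g, p g = 1 → g = 1 ∨ g = z) (hc : ∀ g, z * g = g * z)
    (hzz : z * z = 1) (hg : ∀ g, T.character g ≠ 0 ∨ ∃ h, h * g * h⁻¹ = z * g)
    {y : RepRing G} (hy : y ∈ genuinePart p) : ∃ σ, tensorMap p T σ = y := by
  have hTz : ∀ g, T.character (z * g) = -T.character g := fun g => by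
    simp only [FDRep.character, map_mul, hT, neg_mul, one_mul, map_neg]
  have hyz := charMap_mul_of_mem_genuinePart hk hc hzz hy
  -- Numerator and denominator both change sign under `z`, so the quotient does not depend on the
  -- lift. Where the character of `T` is zero, division gives 0, and this is harmless because `y`
  -- has character zero there too.
  let u : H → ℂ := fun h => charMap G y (Function.surjInv hp h) /
    T.character (Function.surjInv hp h)
  have hu : ∀ g, u (p g) = charMap G y g / T.character g := by
    intro g
    have h1 : p (Function.surjInv hp (p g) * g⁻¹) = 1 := by
      rw [map_mul, Function.surjInv_eq hp, map_inv, mul_inv_cancel]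
    rcases hk _ h1 with h2 | h2
    · simp only [u]; rw [mul_inv_eq_one.mp h2]
    · simp only [u]; rw [mul_inv_eq_iff_eq_mul.mp h2, hTz, hyz, neg_div_neg_eq]
  obtain ⟨σ, hσ⟩ := exists_charMap_eq u fun g h => by
    obtain ⟨g, rfl⟩ := hp g
    obtain ⟨h, rfl⟩ := hp h
    rw [← map_inv, ← map_mul, ← map_mul, hu, hu, charMap_conj, FDRep.char_conj]
  refine ⟨σ, charMap_injective (funext fun g => ?_)⟩
  rw [charMap_tensorMap, hσ, hu]
  rcases hg g with h | ⟨h, hh⟩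
  · rw [div_mul_cancel₀ _ h]
  · have h1 : charMap G y g = 0 := by
      rw [← self_eq_neg, ← hyz, ← hh, charMap_conj]
    rw [h1, zero_div, zero_mul]

/-- If the character of `T` vanishes at an element `g` not conjugate to `z * g`, then tensoring
with `T` is not surjective onto the genuine part. -/
lemma exists_notMem_range_tensorMap [Finite G] (hz : p z = 1)
    (hk : ∀ g, p g = 1 → g = 1 ∨ g = z) (hc : ∀ g, z * g = g * z)
    (hzz : z * z = 1) {g : G} (hg : T.character g = 0) (hgz : ∀ h, h * g * h⁻¹ ≠ z * g) :
    ∃ y ∈ genuinePart p, ∀ σ, tensorMap p T σ ≠ y := by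
  classical
  suffices h : ∃ X : FDRep ℂ G, Simple X ∧ IsGenuine p X ∧ X.character g ≠ 0 by
    obtain ⟨X, hX, hXg, h0⟩ := h
    refine ⟨repClass X, Submodule.subset_span ⟨X, hX, hXg, rfl⟩, fun σ hσ => h0 ?_⟩
    rw [← charMap_repClass, ← hσ, charMap_tensorMap, hg, mul_zero]
  by_contra! hall
  -- If all genuine characters vanished at `g`, every class function would agree at `g` and `z * g`;
  -- the indicator of the class of `g` does not.
  let f : G → ℂ := fun k => if IsConj g k then 1 else 0
  obtain ⟨x, hx⟩ := exists_charMap_eq f fun k h => by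
    have : IsConj g (h * k * h⁻¹) ↔ IsConj g k :=
      ⟨fun h1 => h1.trans (isConj_iff.mpr ⟨h⁻¹, by group⟩),
        fun h1 => h1.trans (isConj_iff.mpr ⟨h, rfl⟩)⟩
    simp only [f, this]
  have hx' : ∀ x : RepRing G, charMap G x (z * g) = charMap G x g := by
    intro x
    have hx : x ∈ Submodule.span ℂ {x | ∃ Y : FDRep ℂ G, Simple Y ∧ True ∧ x = repClass Y} := by
      refine (Submodule.span_le.mpr ?_) (mem_span_repClass x)
      rintro _ ⟨X, rfl⟩
      exact repClass_mem_span (fun _ => True) (fun _ _ _ _ _ => ⟨trivial, trivial⟩) X trivial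
    induction hx using Submodule.span_induction with
    | mem x hx =>
      obtain ⟨X, hX, -, rfl⟩ := hx
      by_cases hXg : IsGenuine p X
      · have h1 := charMap_mul_of_mem_genuinePart hk hc hzz
          (Submodule.subset_span ⟨X, hX, hXg, rfl⟩) g
        rw [h1, charMap_repClass, hall X hX hXg, neg_zero]
      · rw [IsGenuine, not_not] at hXg
        simp only [charMap_repClass, FDRep.character, map_mul, hXg z hz, one_mul]
    | zero => simp
    | add x y _ _ hx hy => simp only [map_add, Pi.add_apply, hx, hy]
    | smul c x _ hx => simp only [map_smul, Pi.smul_apply, hx]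
  have h1 := hx' x
  rw [hx] at h1
  have h2 : ¬ IsConj g (z * g) := fun h => by
    obtain ⟨k, hk⟩ := isConj_iff.mp h
    exact hgz k hk
  simp only [f] at h1
  rw [if_neg h2, if_pos (IsConj.refl g)] at h1
  exact zero_ne_one h1

end GenuineCharacters

/-! ### Products of vectors in the Clifford algebra -/

section CliffordVectors

variable {E : Type*} [NormedAddCommGroup E] [InnerProductSpace ℝ E]

/-- A vector as an element of the Clifford algebra. -/
abbrev clι (v : E) : Cl E := CliffordAlgebra.ι (negForm E) v

lemma clι_mul_self (v : E) : clι v * clι v = algebraMap ℝ (Cl E) (-(inner ℝ v v)) := by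
  rw [CliffordAlgebra.ι_sq_scalar, negForm_apply]

lemma clι_mul_self_of_unit {v : E} (hv : inner ℝ v v = (1 : ℝ)) : clι v * clι v = -1 := by
  rw [clι_mul_self, hv, map_neg, map_one]

lemma clι_mul_swap (v w : E) :
    clι v * clι w = -(clι w * clι v) - algebraMap ℝ (Cl E) (2 * inner ℝ v w) := by
  have h := CliffordAlgebra.ι_mul_ι_add_swap (Q := negForm E) v w
  have h2 : QuadraticMap.polar (negForm E) v w = -(2 * inner ℝ v w) := by
    simp only [QuadraticMap.polar, negForm_apply, inner_add_left, inner_add_right,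
      real_inner_comm v w]
    ring
  rw [h2, map_neg] at h
  rw [eq_sub_iff_add_eq, eq_neg_iff_add_eq_zero]
  rw [add_right_comm, h, neg_add_cancel]

lemma clι_anticomm {v w : E} (h : inner ℝ v w = (0 : ℝ)) : clι v * clι w = -(clι w * clι v) := by
  rw [clι_mul_swap, h, mul_zero, map_zero, sub_zero]

/-- The product of a list of vectors. -/
def clProd (l : List E) : Cl E := (l.map clι).prod

@[simp] lemma clProd_nil : clProd ([] : List E) = 1 := rfl

@[simp] lemma clProd_cons (v : E) (l : List E) : clProd (v :: l) = clι v * clProd l := by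
  simp [clProd]

@[simp] lemma clProd_append (l l' : List E) : clProd (l ++ l') = clProd l * clProd l' := by
  simp [clProd]

lemma involute_clProd (l : List E) :
    CliffordAlgebra.involute (clProd l) = (-1 : ℝ) ^ l.length • clProd l :=
  CliffordAlgebra.involute_prod_map_ι l

/-- The product `v l` differs from `± l v` by a combination of products of fewer vectors. -/
lemma clι_mul_clProd (v : E) (l : List E) :
    ∃ r : Cl E, clι v * clProd l = (-1 : ℝ) ^ l.length • (clProd l * clι v) + r ∧
      ∀ n, l.length = n + 1 → r ∈ Submodule.span ℝ {x |
        ∃ l' : List E, l'.length = n ∧ x = clProd l'} := by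
  induction l with
  | nil => exact ⟨0, by simp, by simp⟩
  | cons w l ih =>
    obtain ⟨r, hr, hmem⟩ := ih
    refine ⟨-(algebraMap ℝ (Cl E) (2 * inner ℝ v w) * clProd l) - clι w * r, ?_, ?_⟩
    · rw [clProd_cons, ← mul_assoc, clι_mul_swap, sub_mul, neg_mul, mul_assoc, hr, mul_add,
        List.length_cons, pow_succ, mul_neg_one, neg_smul, mul_smul_comm, mul_assoc]
      abel
    · intro n hn
      rw [List.length_cons, add_left_inj] at hn
      refine sub_mem (neg_mem ?_) ?_
      · rw [← Algebra.smul_def]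
        exact Submodule.smul_mem _ _ (Submodule.subset_span ⟨l, hn, rfl⟩)
      · cases n with
        | zero =>
          have hl : l = [] := List.length_eq_zero_iff.mp hn
          subst hl
          have : r = 0 := by simpa using hr
          rw [this, mul_zero]
          exact zero_mem _
        | succ n =>
          have := hmem n hn
          clear hr hmem
          induction this using Submodule.span_induction with
          | mem x hx =>
            obtain ⟨l', hl', rfl⟩ := hx
            exact Submodule.subset_span ⟨w :: l', by simp [hl'], by simp⟩
          | zero => simp
          | add x y _ _ hx hy => rw [mul_add]; exact add_mem hx hy
          | smul c x _ hx => rw [mul_smul_comm]; exact Submodule.smul_mem _ _ hx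

/-- A trace function on the Clifford algebra that vanishes at `1` vanishes on even products. -/
lemma trace_clProd_eq_zero {A : Type*} [AddCommGroup A] [Module ℝ A] (f : Cl E →ₗ[ℝ] A)
    (hf : ∀ x y, f (x * y) = f (y * x)) (h1 : f 1 = 0) (n : ℕ) (l : List E)
    (hl : l.length = 2 * n) : f (clProd l) = 0 := by
  induction n generalizing l with
  | zero =>
    have hl : l = [] := List.length_eq_zero_iff.mp hl
    simp [hl, h1]
  | succ n ih =>
    cases l with
    | nil => simp at hl
    | cons v l =>
      have hl' : l.length = 2 * n + 1 := by
        rw [List.length_cons] at hl; omega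
      obtain ⟨r, hr, hmem⟩ := clι_mul_clProd v l
      have hr0 : f r = 0 := by
        have := hmem _ hl'
        clear hr hmem
        induction this using Submodule.span_induction with
        | mem x hx =>
          obtain ⟨l', hl', rfl⟩ := hx
          exact ih l' hl'
        | zero => simp
        | add x y _ _ hx hy => rw [map_add, hx, hy, add_zero]
        | smul c x _ hx => rw [map_smul, hx, smul_zero]
      have h2 := congrArg f hr
      rw [map_add, map_smul, hr0, add_zero, hf, hl', pow_succ, pow_mul] at h2
      -- Moving `v` past the odd number of vectors of `l` costs a sign, up to shorter even products,
      -- which `f` kills by induction; the trace property undoes the move.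
      have h3 : f (clProd l * clι v) = -f (clProd l * clι v) := by simpa using h2
      have h4 : f (clProd (v :: l)) = f (clProd l * clι v) := by
        rw [← hf]; simp
      have h5 : (2 : ℝ) • f (clProd l * clι v) = 0 := by
        rw [two_smul]; nth_rewrite 1 [h3]; simp
      rw [h4]
      exact (smul_eq_zero_iff_right two_ne_zero).mp h5

/-- Elements of the Clifford algebra fixed by all `a ↦ v⁻¹ ε(a) v` are scalars. -/
lemma exists_algebraMap_of_involute_mul_eq [FiniteDimensional ℝ E] {a : Cl E}
    (ha : ∀ v : E, CliffordAlgebra.involute a * clι v = clι v * a) :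
    ∃ c : ℝ, a = algebraMap ℝ (Cl E) c := by
  let b := stdOrthonormalBasis ℝ E
  have hon := b.orthonormal
  suffices h : ∀ s : Finset (Fin (Module.finrank ℝ E)),
      a ∈ Algebra.adjoin ℝ ((fun i => clι (b i)) '' (s : Set (Fin (Module.finrank ℝ E)))) →
        ∃ c : ℝ, a = algebraMap ℝ (Cl E) c by
    apply h Finset.univ
    have h1 : Algebra.adjoin ℝ ((fun i => clι (b i)) ''
        ((Finset.univ : Finset (Fin (Module.finrank ℝ E))) : Set _)) = ⊤ := by
      rw [eq_top_iff, ← CliffordAlgebra.adjoin_range_ι]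
      apply Algebra.adjoin_le
      rintro _ ⟨v, rfl⟩
      rw [← b.sum_repr v, map_sum]
      refine sum_mem fun i _ => ?_
      rw [map_smul]
      refine Subalgebra.smul_mem _ (Algebra.subset_adjoin ?_) _
      exact ⟨i, by simp, rfl⟩
    rw [h1]; trivial
  intro s
  induction s using Finset.induction_on with
  | empty =>
    intro h
    rw [Finset.coe_empty, Set.image_empty, Algebra.adjoin_empty, Algebra.mem_bot] at h
    obtain ⟨c, hc⟩ := h
    exact ⟨c, hc.symm⟩
  | insert i s hi ih =>
    intro h
    set S : Set (Cl E) := (fun i => clι (b i)) '' (s : Set (Fin (Module.finrank ℝ E))) with hS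
    set e : Cl E := clι (b i) with he
    have hee : e * e = -1 := clι_mul_self_of_unit (by
      rw [real_inner_self_eq_norm_sq, hon.1 i]; norm_num)
    have hinvS : ∀ y ∈ Algebra.adjoin ℝ S, CliffordAlgebra.involute y ∈ Algebra.adjoin ℝ S ∧
        y * e = e * CliffordAlgebra.involute y := by
      intro y hy
      induction hy using Algebra.adjoin_induction with
      | mem x hx =>
        have hx' := hx
        obtain ⟨j, hj, rfl⟩ := hx
        simp only [CliffordAlgebra.involute_ι]
        refine ⟨neg_mem (Algebra.subset_adjoin hx'), ?_⟩
        rw [mul_neg]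
        exact clι_anticomm (hon.2 (by rintro rfl; exact hi hj))
      | algebraMap r =>
        rw [AlgHom.commutes]
        exact ⟨Subalgebra.algebraMap_mem _ r, Algebra.commutes r e⟩
      | add x y _ _ hx hy =>
        rw [map_add]
        exact ⟨add_mem hx.1 hy.1, by rw [add_mul, hx.2, hy.2, mul_add]⟩
      | mul x y _ _ hx hy =>
        rw [map_mul]
        exact ⟨mul_mem hx.1 hy.1, by rw [mul_assoc, hy.2, ← mul_assoc, hx.2, mul_assoc]⟩
    have hdec : ∀ x ∈ Algebra.adjoin ℝ ((fun i => clι (b i)) '' ((insert i s :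
        Finset (Fin (Module.finrank ℝ E))) : Set _)),
        ∃ y ∈ Algebra.adjoin ℝ S, ∃ z ∈ Algebra.adjoin ℝ S, x = y + e * z := by
      intro x hx
      induction hx using Algebra.adjoin_induction with
      | mem x hx =>
        obtain ⟨j, hj, rfl⟩ := hx
        rw [Finset.mem_coe, Finset.mem_insert] at hj
        rcases hj with rfl | hj
        · exact ⟨0, zero_mem _, 1, one_mem _, by simp [he]⟩
        · exact ⟨_, Algebra.subset_adjoin ⟨j, hj, rfl⟩, 0, zero_mem _, by simp⟩
      | algebraMap r => exact ⟨_, Subalgebra.algebraMap_mem _ r, 0, zero_mem _, by simp⟩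
      | add x x' _ _ hx hx' =>
        obtain ⟨y, hy, z, hz, rfl⟩ := hx
        obtain ⟨y', hy', z', hz', rfl⟩ := hx'
        exact ⟨_, add_mem hy hy', _, add_mem hz hz', by rw [mul_add]; abel⟩
      | mul x x' _ _ hx hx' =>
        obtain ⟨y, hy, z, hz, rfl⟩ := hx
        obtain ⟨y', hy', z', hz', rfl⟩ := hx'
        refine ⟨y * y' - CliffordAlgebra.involute z * z', sub_mem (mul_mem hy hy')
          (mul_mem (hinvS z hz).1 hz'), CliffordAlgebra.involute y * z' + z * y',
          add_mem (mul_mem (hinvS y hy).1 hz') (mul_mem hz hy'), ?_⟩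
        have h1 : y * (e * z') = e * (CliffordAlgebra.involute y * z') := by
          rw [← mul_assoc, (hinvS y hy).2, mul_assoc]
        have h2 : e * z * (e * z') = -(CliffordAlgebra.involute z * z') := by
          rw [mul_assoc, ← mul_assoc z, (hinvS z hz).2, ← mul_assoc, ← mul_assoc, hee]
          simp
        rw [add_mul, mul_add, mul_add, h1, h2, mul_add, mul_assoc]
        abel
    obtain ⟨y, hy, z, hz, hyz⟩ := hdec a h
    -- Here `a = y + e * z`, with `y` and `z` not involving `e`. The twisted commutation with `e`
    -- reduces to `z = -z`, so `e` does not occur in `a`.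
    have h1 := ha (b i)
    rw [← he, hyz, map_add, map_mul, he, CliffordAlgebra.involute_ι, ← he, add_mul,
      (hinvS _ (hinvS y hy).1).2, CliffordAlgebra.involute_involute, mul_add, mul_assoc,
      (hinvS _ (hinvS z hz).1).2, CliffordAlgebra.involute_involute, add_right_inj, neg_mul,
      ← mul_assoc, hee, neg_one_mul, neg_neg] at h1
    have h2 : z = 0 := by
      have h3 : (2 : ℝ) • z = 0 := by
        rw [two_smul]; nth_rewrite 1 [h1]; simp
      exact (smul_eq_zero_iff_right two_ne_zero).mp h3
    apply ih
    rw [hyz, h2, mul_zero, add_zero]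
    exact hy

end CliffordVectors

/-! ### The Pin group, its kernel, and lifts of reflections -/

section PinCover

variable {E : Type*} [NormedAddCommGroup E] [InnerProductSpace ℝ E]

/-- `r` is the reflection in the unit vector `v`. -/
structure IsReflectionIn (r : E ≃ₗ[ℝ] E) (v : E) : Prop where
  inner_self : inner ℝ v v = (1 : ℝ)
  apply_eq : ∀ x, r x = x - (2 * inner ℝ x v) • v

lemma IsReflectionIn.apply_self {r : E ≃ₗ[ℝ] E} {v : E} (h : IsReflectionIn r v) : r v = -v := by
  rw [h.apply_eq, h.inner_self, mul_one, two_smul]; abel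

lemma IsReflectionIn.mul_self {r : E ≃ₗ[ℝ] E} {v : E} (h : IsReflectionIn r v) : r * r = 1 := by
  ext x
  rw [LinearEquiv.mul_apply, h.apply_eq x, map_sub, map_smul, h.apply_self, h.apply_eq x]
  simp

lemma IsReflectionIn.inv_eq {r : E ≃ₗ[ℝ] E} {v : E} (h : IsReflectionIn r v) : r⁻¹ = r :=
  inv_eq_of_mul_eq_one_left h.mul_self

/-- A unit vector as an element of the Pin group. -/
def vecUnit (v : E) (hv : inner ℝ v v = (1 : ℝ)) : (Cl E)ˣ where
  val := clι v
  inv := -clι v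
  val_inv := by rw [mul_neg, clι_mul_self_of_unit hv, neg_neg]
  inv_val := by rw [neg_mul, clι_mul_self_of_unit hv, neg_neg]

lemma IsReflectionIn.actsBy {r : E ≃ₗ[ℝ] E} {v : E} (h : IsReflectionIn r v) :
    ActsBy (vecUnit v h.inner_self) r := by
  intro x
  change CliffordAlgebra.involute (clι v) * clι x * (-clι v) = clι (r x)
  rw [CliffordAlgebra.involute_ι, h.apply_eq]
  change -clι v * clι x * (-clι v) = _
  have h1 : clι v * clι x * clι v = clι x - (2 * inner ℝ x v : ℝ) • clι v := by
    rw [clι_mul_swap, sub_mul, neg_mul, mul_assoc, clι_mul_self_of_unit h.inner_self,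
      ← Algebra.smul_def, real_inner_comm v x]
    simp
  rw [neg_mul, neg_mul_neg, h1]
  simp only [clι, map_sub, map_smul]

/-- A lift of a reflection to the Pin group. -/
def IsReflectionIn.lift {r : E ≃ₗ[ℝ] E} {v : E} (h : IsReflectionIn r v) : Pin E :=
  ⟨vecUnit v h.inner_self, CliffordAlgebra.star_ι v, r, h.actsBy⟩

lemma IsReflectionIn.coe_lift {r : E ≃ₗ[ℝ] E} {v : E} (h : IsReflectionIn r v) :
    ((h.lift : (Cl E)ˣ) : Cl E) = clι v := rfl

lemma pinHom_eq_of_actsBy {a : Pin E} {g : E ≃ₗ[ℝ] E} (h : ActsBy (a : (Cl E)ˣ) g) :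
    pinHom E a = g := (pinHom_spec E a).unique h

lemma IsReflectionIn.pinHom_lift {r : E ≃ₗ[ℝ] E} {v : E} (h : IsReflectionIn r v) :
    pinHom E h.lift = r := pinHom_eq_of_actsBy h.actsBy

/-- The nontrivial element of the kernel of the double cover. -/
def pinNegOne : Pin E :=
  ⟨-1, by simp, 1, fun v => by simp⟩

lemma coe_pinNegOne : (((pinNegOne : Pin E) : (Cl E)ˣ) : Cl E) = -1 := rfl

lemma pinHom_pinNegOne : pinHom E pinNegOne = 1 :=
  pinHom_eq_of_actsBy (fun v => by simp [pinNegOne])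

lemma pin_ext {a b : Pin E} (h : ((a : (Cl E)ˣ) : Cl E) = ((b : (Cl E)ˣ) : Cl E)) : a = b :=
  Subtype.ext (Units.ext h)

lemma involute_mul_clι (a : Pin E) (v : E) :
    CliffordAlgebra.involute ((a : (Cl E)ˣ) : Cl E) * clι v =
      clι (pinHom E a v) * ((a : (Cl E)ˣ) : Cl E) := by
  rw [clι, clι, ← pinHom_spec E a v, mul_assoc, Units.inv_mul, mul_one]

/-- An element of the kernel satisfies `ε(a) v = v a` for all vectors, hence is a real scalar, and
`aᵗ a = 1` makes its square 1. -/
lemma eq_one_or_of_pinHom_eq_one [FiniteDimensional ℝ E] {a : Pin E} (h : pinHom E a = 1) :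
    a = 1 ∨ a = pinNegOne := by
  obtain ⟨c, hc⟩ := exists_algebraMap_of_involute_mul_eq (a := ((a : (Cl E)ˣ) : Cl E)) fun v => by
    rw [involute_mul_clι, h]; rfl
  have h1 : algebraMap ℝ (Cl E) (c * c) = algebraMap ℝ (Cl E) 1 := by
    have h2 := a.2.1
    have h3 : star ((a : (Cl E)ˣ) : Cl E) * ((a : (Cl E)ˣ) : Cl E) = 1 := by
      rw [h2, Units.inv_mul]
    rw [hc, CliffordAlgebra.star_algebraMap, ← map_mul] at h3
    rw [h3, map_one]
  rcases mul_self_eq_one_iff.mp ((algebraMap ℝ (Cl E)).injective h1) with h | h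
  · left; apply pin_ext; rw [hc, h, map_one]; rfl
  · right; apply pin_ext; rw [hc, h, map_neg, map_one]; rfl

lemma pinNegOne_mul_self : (pinNegOne : Pin E) * pinNegOne = 1 := by
  apply pin_ext
  simp [coe_pinNegOne]

lemma pinNegOne_mul (a : Pin E) : (((pinNegOne * a : Pin E) : (Cl E)ˣ) : Cl E) =
    -((a : (Cl E)ˣ) : Cl E) := by
  simp [coe_pinNegOne]

lemma pinNegOne_comm (a : Pin E) : pinNegOne * a = a * pinNegOne := by
  apply pin_ext
  simp [coe_pinNegOne]

/-- The element `-1` of the double cover. -/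
def coverNegOne (W : Subgroup (E ≃ₗ[ℝ] E)) : cover W :=
  ⟨pinNegOne, by
    change pinHom E pinNegOne ∈ W
    rw [pinHom_pinNegOne]; exact one_mem W⟩

variable (W : Subgroup (E ≃ₗ[ℝ] E))

lemma coverMap_coverNegOne : coverMap W (coverNegOne W) = 1 := Subtype.ext pinHom_pinNegOne

lemma coverNegOne_comm (a : cover W) : coverNegOne W * a = a * coverNegOne W :=
  Subtype.ext (pinNegOne_comm _)

lemma coverNegOne_mul_self : coverNegOne W * coverNegOne W = 1 := Subtype.ext pinNegOne_mul_self

lemma eq_one_or_of_coverMap_eq_one [FiniteDimensional ℝ E] (a : cover W) (h : coverMap W a = 1) :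
    a = 1 ∨ a = coverNegOne W :=
  (eq_one_or_of_pinHom_eq_one (congrArg Subtype.val h)).imp Subtype.ext Subtype.ext

lemma cover_finite [FiniteDimensional ℝ E] [Finite W] : Finite (cover W) := by
  have : Finite (coverMap W).ker := by
    refine Set.Finite.subset (s := {1, coverNegOne W}) (by simp) ?_
    intro a ha
    exact eq_one_or_of_coverMap_eq_one W a ha
  exact (MonoidHom.finite_iff_finite_ker_range (coverMap W)).mpr ⟨inferInstance, inferInstance⟩

variable {W} {κ : Type*} {u : κ → E} {s : κ → E ≃ₗ[ℝ] E} (hs : ∀ i, IsReflectionIn (s i) (u i))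

include hs in
lemma exists_list_of_mem_closure_reflections {w : E ≃ₗ[ℝ] E}
    (hw : w ∈ Subgroup.closure (Set.range s)) :
    ∃ l : List κ, w = (l.map s).prod := by
  induction hw using Subgroup.closure_induction with
  | mem x hx =>
    obtain ⟨i, rfl⟩ := hx
    exact ⟨[i], by simp⟩
  | one => exact ⟨[], by simp⟩
  | mul x y _ _ hx hy =>
    obtain ⟨l, rfl⟩ := hx
    obtain ⟨l', rfl⟩ := hy
    exact ⟨l ++ l', by simp⟩
  | inv x _ hx =>
    obtain ⟨l, rfl⟩ := hx
    refine ⟨l.reverse, ?_⟩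
    rw [List.prod_inv_reverse, List.map_map, List.map_reverse]
    congr 2
    exact List.map_congr_left fun i _ => (hs i).inv_eq

include hs in
lemma exists_pin_lift (l : List κ) : ∃ a : Pin E, ((a : (Cl E)ˣ) : Cl E) = clProd (l.map u) ∧
    pinHom E a = (l.map s).prod := by
  induction l with
  | nil => exact ⟨1, rfl, map_one _⟩
  | cons i l ih =>
    obtain ⟨a, ha, hp⟩ := ih
    refine ⟨(hs i).lift * a, ?_, ?_⟩
    · simp [ha, (hs i).coe_lift]
    · rw [map_mul, (hs i).pinHom_lift, hp]; simp

include hs in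
lemma coverMap_surjective (hW : W = Subgroup.closure (Set.range s)) :
    Function.Surjective (coverMap W) := by
  rintro ⟨w, hw⟩
  obtain ⟨l, hl⟩ := exists_list_of_mem_closure_reflections hs (hW ▸ hw)
  obtain ⟨a, -, ha⟩ := exists_pin_lift hs l
  rw [← hl] at ha
  refine ⟨⟨a, ?_⟩, Subtype.ext ha⟩
  change pinHom E a ∈ W
  rwa [ha]

include hs in
lemma exists_list_of_mem_cover [FiniteDimensional ℝ E]
    (hW : W = Subgroup.closure (Set.range s)) (g : cover W) :
    ∃ l : List κ, pinHom E g = (l.map s).prod ∧ ((((g : Pin E) : (Cl E)ˣ) : Cl E) =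
        clProd (l.map u) ∨
      (((g : Pin E) : (Cl E)ˣ) : Cl E) = -clProd (l.map u)) := by
  have hg : pinHom E g ∈ Subgroup.closure (Set.range s) := by
    rw [← hW]; exact g.2
  obtain ⟨l, hl⟩ := exists_list_of_mem_closure_reflections hs hg
  obtain ⟨a, ha, hp⟩ := exists_pin_lift hs l
  refine ⟨l, hl, ?_⟩
  have h1 : pinHom E ((g : Pin E) * a⁻¹) = 1 := by
    rw [map_mul, map_inv, hp, mul_inv_eq_one]
    exact hl
  rcases eq_one_or_of_pinHom_eq_one h1 with h | h
  · left; rw [mul_inv_eq_one.mp h, ha]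
  · right; rw [mul_inv_eq_iff_eq_mul.mp h, pinNegOne_mul, ha]

end PinCover

/-! ### The trace on the spin module -/

section SpinCharacter

variable {E : Type*} [NormedAddCommGroup E] [InnerProductSpace ℝ E]
  (S : Type) [AddCommGroup S] [Module ℂ S] [Module (ClC E) S] [IsScalarTower ℂ (ClC E) S]

/-- The trace on a module over the complex Clifford algebra. -/
def clTrace : Cl E →ₗ[ℝ] ℂ :=
  (LinearMap.trace ℂ S).restrictScalars ℝ ∘ₗ
    ((Algebra.lsmul ℂ ℂ S : ClC E →ₐ[ℂ] Module.End ℂ S).toLinearMap.restrictScalars ℝ) ∘ₗ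
      (toClC E).toLinearMap

lemma clTrace_apply (x : Cl E) : clTrace S x =
    LinearMap.trace ℂ S (Algebra.lsmul ℂ ℂ S (toClC E x)) := rfl

lemma clTrace_mul_comm (x y : Cl E) : clTrace S (x * y) = clTrace S (y * x) := by
  simp only [clTrace_apply, map_mul]
  exact LinearMap.trace_mul_comm _ _ _

lemma character_spinRep [Module.Finite ℂ S] (W : Subgroup (E ≃ₗ[ℝ] E)) (g : cover W) :
    (FDRep.of (spinRep W S)).character g = clTrace S (((g : Pin E) : (Cl E)ˣ) : Cl E) := rfl

lemma spinRep_coverNegOne [Module.Finite ℂ S] (W : Subgroup (E ≃ₗ[ℝ] E)) :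
    (FDRep.of (spinRep W S)).ρ (coverNegOne W) = -1 := by
  change Algebra.lsmul ℂ ℂ S (toClC E (-1)) = -1
  rw [map_neg, map_neg, map_one, map_one]

lemma clTrace_one [Module.Finite ℂ S] : clTrace S (1 : Cl E) = Module.finrank ℂ S := by
  rw [clTrace_apply, map_one, map_one, LinearMap.trace_one]

/-- On even products, the trace on `S` is proportional to any other trace function. -/
lemma clTrace_mul_eq (t : Cl E →ₗ[ℝ] ℝ) (ht : ∀ x y, t (x * y) = t (y * x)) (l : List E)
    (hl : Even l.length) : t 1 * clTrace S (clProd l) = t (clProd l) * clTrace S (1 : Cl E) := by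
  obtain ⟨n, hn⟩ := hl
  let f : Cl E →ₗ[ℝ] ℂ := t 1 • clTrace S -
      (clTrace S (1 : Cl E)) • (Complex.ofRealLI.toLinearMap ∘ₗ t)
  have h := trace_clProd_eq_zero f (fun x y => by simp [f, ht x y, clTrace_mul_comm S x y])
    (by simp [f, mul_comm]) n l (by omega)
  have h2 : f (clProd l) = t 1 * clTrace S (clProd l) - clTrace S (1 : Cl E) * t (clProd l) := by
    simp [f]
  rw [h2, sub_eq_zero] at h
  rw [h, mul_comm]

/-- Central elements of the real Clifford algebra act on simple modules by scalars. -/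
lemma exists_scalar_of_central [Module.Finite ℂ S] [IsSimpleModule (ClC E) S] {x : Cl E}
    (hx : ∀ v, x * clι v = clι v * x) :
    ∃ c : ℂ, ∀ m : S, toClC E x • m = c • m := by
  have hc : ∀ y : ClC E, toClC E x * y = y * toClC E x := by
    intro y
    have hy : y ∈ Algebra.adjoin ℂ (Set.range (CliffordAlgebra.ι ((negForm E).baseChange ℂ))) := by
      rw [CliffordAlgebra.adjoin_range_ι]; trivial
    induction hy using Algebra.adjoin_induction with
    | mem y hy =>
      obtain ⟨v, rfl⟩ := hy
      induction v using TensorProduct.induction_on with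
      | zero => simp
      | tmul z v =>
        have h1 : z ⊗ₜ[ℝ] v = z • ((1 : ℂ) ⊗ₜ[ℝ] v) := by simp [TensorProduct.smul_tmul']
        rw [h1, map_smul, ← CliffordAlgebra.ofBaseChangeAux_ι, mul_smul_comm, smul_mul_assoc]
        congr 1
        have h2 := congrArg (toClC E) (hx v)
        rwa [map_mul, map_mul] at h2
      | add v w hv hw => rw [map_add, mul_add, add_mul, hv, hw]
    | algebraMap r => exact (Algebra.commutes r _).symm
    | add y z _ _ hy hz => rw [mul_add, add_mul, hy, hz]
    | mul y z _ _ hy hz => rw [← mul_assoc, hy, mul_assoc, hz, mul_assoc]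
  let F : Module.End (ClC E) S :=
    { toFun := fun m => toClC E x • m
      map_add' := fun a b => smul_add _ a b
      map_smul' := fun y m => by simp [smul_smul, hc y] }
  obtain ⟨c, hc⟩ := (IsSimpleModule.algebraMap_end_bijective_of_isAlgClosed (A := ClC E)
      (V := S) ℂ).2 F
  exact ⟨c, fun m => (LinearMap.congr_fun hc m).symm⟩

lemma clTrace_mul_of_central [Module.Finite ℂ S] [IsSimpleModule (ClC E) S] {x : Cl E}
    (hx : ∀ v, x * clι v = clι v * x) (y : Cl E) (h0 : clTrace S (x * y) ≠ 0) :
    clTrace S y ≠ 0 := by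
  obtain ⟨c, hc⟩ := exists_scalar_of_central S hx
  intro h
  apply h0
  have h1 : Algebra.lsmul ℂ ℂ S (toClC E x) = c • LinearMap.id := LinearMap.ext hc
  rw [clTrace_apply, map_mul, map_mul, h1]
  have h2 : (c • LinearMap.id) * Algebra.lsmul ℂ ℂ S (toClC E y) =
      c • Algebra.lsmul ℂ ℂ S (toClC E y) := by
    ext m; simp
  rw [h2, map_smul, ← clTrace_apply, h, smul_zero]

end SpinCharacter

/-! ### Reduction to even elements -/

section Criterion

variable {E : Type*} [NormedAddCommGroup E] [InnerProductSpace ℝ E]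

lemma clProd_mul_of_neg {a : Cl E} {c : ℝ} (ha : ∀ v, a * clι v = c • (clι v * a)) (l : List E) :
    a * clProd l = c ^ l.length • (clProd l * a) := by
  induction l with
  | nil => simp
  | cons v l ih =>
    rw [clProd_cons, ← mul_assoc, ha, smul_mul_assoc, mul_assoc, ih, mul_smul_comm, smul_smul,
      List.length_cons, pow_succ', mul_assoc]

variable {W : Subgroup (E ≃ₗ[ℝ] E)}

/-- An even element `g` of the double cover is conjugate to `-g` if it negates some root. -/
lemma exists_conj_eq_neg_of_even (g : cover W)
    (heven : CliffordAlgebra.involute (((g : Pin E) : (Cl E)ˣ) : Cl E) =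
      (((g : Pin E) : (Cl E)ˣ) : Cl E))
    {r : E ≃ₗ[ℝ] E} {β : E} (hr : r ∈ W) (hβ : IsReflectionIn r β) (hg : pinHom E g β = -β) :
    ∃ h : cover W, h * g * h⁻¹ = coverNegOne W * g := by
  refine ⟨⟨hβ.lift, by change pinHom E hβ.lift ∈ W; rwa [hβ.pinHom_lift]⟩, ?_⟩
  rw [mul_inv_eq_iff_eq_mul]
  apply Subtype.ext
  apply pin_ext
  -- With `ε(g) = g` and `g β = -β` this says that `g` and `β` anticommute in the Clifford algebra.
  have h1 := involute_mul_clι (g : Pin E) β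
  rw [heven, hg] at h1
  simp only [clι, map_neg, neg_mul] at h1
  simp [hβ.coe_lift, coverNegOne, coe_pinNegOne, h1]

variable [FiniteDimensional ℝ E] {κ : Type*} {u : κ → E} {s : κ → E ≃ₗ[ℝ] E}
  (S : Type) [AddCommGroup S] [Module ℂ S] [Module (ClC E) S] [IsScalarTower ℂ (ClC E) S]

/-- A lift `ω` of -1 transfers the dichotomy from even words to all elements: `ω` commutes or
anticommutes with vectors according to the parity of its own length. -/
lemma clTrace_ne_zero_or_conj [Module.Finite ℂ S] [IsSimpleModule (ClC E) S]
    (hs : ∀ i, IsReflectionIn (s i) (u i)) (hW : W = Subgroup.closure (Set.range s))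
    (hneg : LinearEquiv.neg ℝ ∈ W)
    (heven : ∀ l : List κ, Even l.length → clTrace S (clProd (l.map u)) ≠ 0 ∨
      ∃ β, ∃ r ∈ W, IsReflectionIn r β ∧ (l.map s).prod β = -β) (g : cover W) :
    clTrace S (((g : Pin E) : (Cl E)ˣ) : Cl E) ≠ 0 ∨
      ∃ h : cover W, h * g * h⁻¹ = coverNegOne W * g := by
  have hinv : ∀ (g : cover W) (l : List κ),
      ((((g : Pin E) : (Cl E)ˣ) : Cl E) = clProd (l.map u) ∨
        (((g : Pin E) : (Cl E)ˣ) : Cl E) = -clProd (l.map u)) →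
      CliffordAlgebra.involute (((g : Pin E) : (Cl E)ˣ) : Cl E) =
        (-1 : ℝ) ^ l.length • (((g : Pin E) : (Cl E)ˣ) : Cl E) := by
    rintro g l (h | h) <;> simp [h, involute_clProd]
  have main : ∀ (g : cover W) (l : List κ), pinHom E g = (l.map s).prod →
      ((((g : Pin E) : (Cl E)ˣ) : Cl E) = clProd (l.map u) ∨
        (((g : Pin E) : (Cl E)ˣ) : Cl E) = -clProd (l.map u)) → Even l.length →
      clTrace S (((g : Pin E) : (Cl E)ˣ) : Cl E) ≠ 0 ∨
        ∃ h : cover W, h * g * h⁻¹ = coverNegOne W * g := by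
    intro g l hp hl hev
    rcases heven l hev with h | ⟨β, r, hr, hβ, h⟩
    · left
      rcases hl with hl | hl
      · rwa [hl]
      · rwa [hl, map_neg, neg_ne_zero]
    · right
      refine exists_conj_eq_neg_of_even g ?_ hr hβ (by rw [hp, h])
      rw [hinv g l hl, hev.neg_one_pow, one_smul]
  obtain ⟨l, hp, hl⟩ := exists_list_of_mem_cover hs hW g
  rcases Nat.even_or_odd l.length with hev | hodd
  · exact main g l hp hl hev
  obtain ⟨⟨ω, hωW⟩, hω⟩ := coverMap_surjective hs hW ⟨_, hneg⟩
  have hωp : pinHom E ω = LinearEquiv.neg ℝ := congrArg Subtype.val hω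
  obtain ⟨l₀, hp₀, hl₀⟩ := exists_list_of_mem_cover hs hW ⟨ω, hωW⟩
  have hωinv := hinv ⟨ω, hωW⟩ l₀ hl₀
  have hωv : ∀ v, ((ω : (Cl E)ˣ) : Cl E) * clι v =
      (-(-1 : ℝ) ^ l₀.length) • (clι v * ((ω : (Cl E)ˣ) : Cl E)) := by
    intro v
    have h1 := involute_mul_clι ω v
    rw [hωinv, hωp, LinearEquiv.neg_apply] at h1
    simp only [clι, map_neg, neg_mul, smul_mul_assoc] at h1
    have h2 : ((-1 : ℝ) ^ l₀.length) * ((-1 : ℝ) ^ l₀.length) = 1 := by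
      rw [← mul_pow]; simp
    have h3 := congrArg (((-1 : ℝ) ^ l₀.length) • ·) h1
    simp only [smul_smul, h2, one_smul, smul_neg] at h3
    rw [neg_smul]
    exact h3
  -- If `ω` is even, it anticommutes with every vector, hence with the odd element `g`, so it
  -- conjugates `g` to `-g`.
  rcases Nat.even_or_odd l₀.length with hev₀ | hodd₀
  · right
    refine ⟨⟨ω, hωW⟩, ?_⟩
    rw [mul_inv_eq_iff_eq_mul]
    apply Subtype.ext
    apply pin_ext
    rw [hev₀.neg_one_pow] at hωv
    have h1 := clProd_mul_of_neg hωv (l.map u)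
    rw [List.length_map, hodd.neg_one_pow, neg_one_smul] at h1
    rcases hl with hl | hl <;> simp [hl, coverNegOne, coe_pinNegOne, h1]
  -- If `ω` is odd, it is central in the cover and acts on `S` by a scalar, so `g` can be replaced
  -- by the even element `ω * g`.
  · rw [hodd₀.neg_one_pow, neg_neg] at hωv
    simp only [one_smul] at hωv
    have hcomm : ∀ g : cover W, (⟨ω, hωW⟩ : cover W) * g = g * ⟨ω, hωW⟩ := by
      intro g
      obtain ⟨l, -, hl⟩ := exists_list_of_mem_cover hs hW g
      apply Subtype.ext
      apply pin_ext
      have h1 := clProd_mul_of_neg (c := 1) (by simpa using hωv) (l.map u)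
      rw [one_pow, one_smul] at h1
      rcases hl with hl | hl <;> simp [hl, h1]
    rcases main (⟨ω, hωW⟩ * g) (l₀ ++ l) (by simp [hp, ← hp₀])
      (by
        rcases hl with hl | hl <;> rcases hl₀ with hl₀ | hl₀ <;> simp at hl₀ <;> simp [hl, hl₀])
      (by rw [List.length_append]; exact hodd₀.add_odd hodd) with h | ⟨h, hh⟩
    · left
      exact clTrace_mul_of_central S hωv _ h
    · right
      refine ⟨h, ?_⟩
      have h1 : h * (⟨ω, hωW⟩ * g) * h⁻¹ = ⟨ω, hωW⟩ * (h * g * h⁻¹) := by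
        rw [← mul_assoc, ← hcomm]; simp only [mul_assoc]
      rw [h1, ← mul_assoc (coverNegOne W), coverNegOne_comm] at hh
      exact mul_left_cancel (hh.trans (mul_assoc _ _ _))

end Criterion

/-! ### A model of the Clifford algebra by 2 × 2 quaternionic matrices -/

section QuaternionModel

open Quaternion

variable {E : Type*} [NormedAddCommGroup E] [InnerProductSpace ℝ E] {θ : E →ₗ[ℝ] ℍ[ℝ]}
  (hθ : ∀ v, normSq (θ v) = inner ℝ v v)

/-- The matrix of a vector in the quaternionic model of the Clifford algebra. -/
def quatMat (θ : E →ₗ[ℝ] ℍ[ℝ]) : E →ₗ[ℝ] Matrix (Fin 2) (Fin 2) ℍ[ℝ] where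
  toFun v := !![0, θ v; -star (θ v), 0]
  map_add' v w := by
    refine Matrix.ext fun i j => ?_
    fin_cases i <;> fin_cases j <;> simp [add_comm]
  map_smul' c v := by
    refine Matrix.ext fun i j => ?_
    fin_cases i <;> fin_cases j <;> simp

/-- The quaternionic model of the Clifford algebra given by an isometric map to the quaternions. -/
def quatModel : Cl E →ₐ[ℝ] Matrix (Fin 2) (Fin 2) ℍ[ℝ] :=
  CliffordAlgebra.lift (negForm E) ⟨quatMat θ, fun v => by
    rw [negForm_apply, ← hθ]
    refine Matrix.ext fun i j => ?_
    fin_cases i <;> fin_cases j <;>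
      simp [quatMat, Matrix.mul_apply, Matrix.algebraMap_matrix_apply, Quaternion.self_mul_star,
        Quaternion.star_mul_self]⟩

@[simp] lemma quatModel_clι (v : E) : quatModel hθ (clι v) = !![0, θ v; -star (θ v), 0] := by
  rw [quatModel, clι, CliffordAlgebra.lift_ι_apply]; rfl

/-- The trace function of the quaternionic model. -/
def quatTrace : Cl E →ₗ[ℝ] ℝ where
  toFun x := (quatModel hθ x 0 0).re + (quatModel hθ x 1 1).re
  map_add' x y := by simp; ring
  map_smul' c x := by simp; ring

lemma quatTrace_mul_comm (x y : Cl E) : quatTrace hθ (x * y) = quatTrace hθ (y * x) := by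
  simp [quatTrace, Matrix.mul_apply]
  ring

/-- The nonzero entries of the product of the matrices of a list of quaternions. -/
def pairOf : List ℍ[ℝ] → ℍ[ℝ] × ℍ[ℝ]
  | [] => (1, 1)
  | q :: l => (q * (pairOf l).2, -star q * (pairOf l).1)

/-- Vectors have antidiagonal matrices, so even products are diagonal and odd ones antidiagonal;
`pairOf` tracks the two entries. -/
lemma quatModel_clProd (l : List E) : quatModel hθ (clProd l) =
    if Even l.length then !![(pairOf (l.map θ)).1, 0; 0, (pairOf (l.map θ)).2]
    else !![0, (pairOf (l.map θ)).1; (pairOf (l.map θ)).2, 0] := by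
  induction l with
  | nil => simp [pairOf, Matrix.one_fin_two]
  | cons v l ih =>
    rw [clProd_cons, map_mul, ih, quatModel_clι]
    by_cases h : Even l.length
    · rw [if_pos h, if_neg (by rw [List.length_cons]; simpa [Nat.even_add_one] using h)]
      refine Matrix.ext fun i j => ?_
      fin_cases i <;> fin_cases j <;> simp [Matrix.mul_apply, pairOf]
    · rw [if_neg h, if_pos (by rw [List.length_cons]; simpa [Nat.even_add_one] using h)]
      refine Matrix.ext fun i j => ?_
      fin_cases i <;> fin_cases j <;> simp [Matrix.mul_apply, pairOf]

lemma normSq_pairOf {l : List ℍ[ℝ]} (hl : ∀ q ∈ l, normSq q = 1) :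
    normSq (pairOf l).1 = 1 ∧ normSq (pairOf l).2 = 1 := by
  induction l with
  | nil => simp [pairOf]
  | cons q l ih =>
    have h := ih fun q hq => hl q (List.mem_cons_of_mem _ hq)
    have hq := hl q List.mem_cons_self
    simp [pairOf, h, hq, Quaternion.normSq_neg, Quaternion.normSq_star]

variable {κ : Type*} {u : κ → E} {s : κ → E ≃ₗ[ℝ] E}

-- This is the upper right entry of `ε(a) v = (p(a) v) a` in the quaternionic model. It reads the
-- action on vectors off the pair of quaternions.
include hθ in
lemma pairOf_mul (hs : ∀ i, IsReflectionIn (s i) (u i)) (l : List κ) (hl : Even l.length) (v : E) :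
    (pairOf (l.map fun i => θ (u i))).1 * θ v =
      θ ((l.map s).prod v) * (pairOf (l.map fun i => θ (u i))).2 := by
  obtain ⟨a, ha, hp⟩ := exists_pin_lift hs l
  have h1 := involute_mul_clι a v
  rw [ha, hp, involute_clProd, List.length_map, hl.neg_one_pow, one_smul] at h1
  have h2 := congrArg (fun x => quatModel hθ x 0 1) h1
  simp only [map_mul, quatModel_clProd, List.length_map, if_pos hl, quatModel_clι] at h2
  simpa [Matrix.mul_apply, Function.comp_def] using h2

variable [FiniteDimensional ℝ E] {W : Subgroup (E ≃ₗ[ℝ] E)} [Finite W]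
variable (S : Type) [AddCommGroup S] [Module ℂ S] [Module (ClC E) S] [IsScalarTower ℂ (ClC E) S]

include hθ in
/-- Surjectivity of the spin map from the quaternionic description of the even elements. -/
theorem exists_spinMap_eq [Module.Finite ℂ S] [IsSimpleModule (ClC E) S]
    (hs : ∀ i, IsReflectionIn (s i) (u i)) (hW : W = Subgroup.closure (Set.range s))
    (hneg : LinearEquiv.neg ℝ ∈ W)
    (heven : ∀ l : List κ, Even l.length →
      (pairOf (l.map fun i => θ (u i))).1.re + (pairOf (l.map fun i => θ (u i))).2.re ≠ 0 ∨
      ∃ β, ∃ r ∈ W, IsReflectionIn r β ∧ (pairOf (l.map fun i => θ (u i))).1 * θ β =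
        -(θ β * (pairOf (l.map fun i => θ (u i))).2))
    {y : RepRing (cover W)} (hy : y ∈ genuinePart (coverMap W)) : ∃ σ, spinMap W S σ = y := by
  have := cover_finite W
  refine exists_tensorMap_eq _ (coverMap_surjective hs hW) (spinRep_coverNegOne S W)
    (eq_one_or_of_coverMap_eq_one W) (coverNegOne_comm W) (coverNegOne_mul_self W) ?_ hy
  intro g
  rw [character_spinRep]
  refine clTrace_ne_zero_or_conj S hs hW hneg (fun l hl => ?_) g
  rcases heven l hl with h | ⟨β, r, hr, hβ, h⟩
  · left
    intro h0
    -- On even products the traces of `S` and of the model are proportional, and the dimension of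
    -- `S` is nonzero, so a zero of one is a zero of the other.
    have h1 := clTrace_mul_eq S (quatTrace hθ) (quatTrace_mul_comm hθ) (l.map u) (by simpa using hl)
    rw [h0, mul_zero, clTrace_one] at h1
    have hnt : Nontrivial S := IsSimpleModule.nontrivial (ClC E) S
    have h2 : (Module.finrank ℂ S : ℂ) ≠ 0 := Nat.cast_ne_zero.mpr Module.finrank_pos.ne'
    have h3 := (mul_eq_zero.mp h1.symm).resolve_right h2
    apply h
    rw [Complex.ofReal_eq_zero, quatTrace] at h3
    simpa [quatModel_clProd, hl, Function.comp_def] using h3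
  · right
    refine ⟨β, r, hr, hβ, ?_⟩
    have h1 := pairOf_mul hθ hs l hl β
    rw [h, ← neg_mul] at h1
    have hne : (pairOf (l.map fun i => θ (u i))).2 ≠ 0 := by
      have := (normSq_pairOf (l := l.map fun i => θ (u i)) (fun q hq => by
        obtain ⟨i, -, rfl⟩ := List.mem_map.mp hq
        rw [hθ, (hs i).inner_self])).2
      intro h0
      rw [h0, map_zero] at this
      exact zero_ne_one this
    have h2 := mul_right_cancel₀ hne h1
    have hinj : Function.Injective θ := by
      rw [injective_iff_map_eq_zero]
      intro v hv
      have := hθ v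
      rw [hv, map_zero] at this
      exact inner_self_eq_zero.mp this.symm
    apply hinj
    rw [map_neg, h2]

end QuaternionModel

/-! ### Integer arithmetic of the icosians and finite verifications -/

section Icosians

/-- Elements `a + b φ` of the ring of integers of `ℚ(√5)`. -/
abbrev ZPhi := ℤ × ℤ

/-- The product of `ZPhi`. -/
def ZPhi.mul (x y : ZPhi) : ZPhi := (x.1 * y.1 + x.2 * y.2, x.1 * y.2 + x.2 * y.1 + x.2 * y.2)

/-- Quaternions with coordinates in `ZPhi`. -/
abbrev QPhi := ZPhi × ZPhi × ZPhi × ZPhi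

/-- The product of quaternions with coordinates in `ZPhi`. -/
def QPhi.mul : QPhi → QPhi → QPhi
  | (a, b, c, d), (e, f, g, h) =>
    (a.mul e - b.mul f - c.mul g - d.mul h, a.mul f + b.mul e + c.mul h - d.mul g,
      a.mul g - b.mul h + c.mul e + d.mul f, a.mul h + b.mul g - c.mul f + d.mul e)

/-- The inner product of quaternions with coordinates in `ZPhi`. -/
def QPhi.dot : QPhi → QPhi → ZPhi
  | (a, b, c, d), (e, f, g, h) => a.mul e + b.mul f + c.mul g + d.mul h

/-- The product of a quaternion with an element of `ZPhi`. -/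
def QPhi.smul (x : ZPhi) : QPhi → QPhi
  | (a, b, c, d) => (x.mul a, x.mul b, x.mul c, x.mul d)

/-- The double of the reflection of a quaternion in a unit quaternion, if it has coordinates in
`ZPhi`. -/
def QPhi.reflect (q x : QPhi) : QPhi :=
  let d := x.dot q
  let c : ZPhi := (d.1 / 2, d.2 / 2)
  -- Both arguments are doubled, so `d` is four times the inner product and the reflection subtracts
  -- `d / 2` times `q`. The fallback `x` is harmless: reflections are used only to lower the height.
  if d = c + c then x - QPhi.smul c q else x

/-- An element of `ZPhi` and its negative. -/
def ZPhi.signs (x : ZPhi) : List ZPhi := [x, -x]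

/-- The doubles of the 120 unit icosians. -/
def icosians : List QPhi :=
  -- The Klein four-group and a 3-cycle subgroup together give all even permutations of the
  -- coordinates. The three families have 8, 16 and 96 members.
  let v₄ : List (QPhi → QPhi) := [fun (a, b, c, d) => (a, b, c, d), fun (a, b, c, d) =>
      (b, a, d, c),
    fun (a, b, c, d) => (c, d, a, b), fun (a, b, c, d) => (d, c, b, a)]
  let c₃ : List (QPhi → QPhi) := [fun (a, b, c, d) => (a, b, c, d), fun (a, b, c, d) =>
      (a, c, d, b),
    fun (a, b, c, d) => (a, d, b, c)]
  let s : List ZPhi := ZPhi.signs (1, 0)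
  let t₁ : List QPhi := (ZPhi.signs (2, 0)).map fun a => (a, 0, 0, 0)
  let t₂ : List QPhi :=
    s.flatMap fun a => s.flatMap fun b => s.flatMap fun c => s.map fun d => (a, b, c, d)
  let t₃ : List QPhi := s.flatMap fun a => (ZPhi.signs (0, 1)).flatMap fun b =>
    (ZPhi.signs (-1, 1)).map fun c => (a, b, c, 0)
  (t₁.flatMap fun x => v₄.map fun v => v x) ++ t₂ ++
    (t₃.flatMap fun x => c₃.flatMap fun c => v₄.map fun v => v (c x))

/-- The doubles of simple roots of type `H₄`; the last three are simple roots of type `H₃`. -/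
def qSimple : Fin 4 → QPhi
  | 0 => ((-1, 1), 0, (-1, 0), (0, -1))
  | 1 => (0, 0, (2, 0), 0)
  | 2 => (0, (0, -1), (-1, 0), (-1, 1))
  | 3 => (0, (2, 0), 0, 0)

/-- The double of the negative of the conjugate of the first simple root. -/
def qSimpleConj : QPhi := ((1, -1), 0, (-1, 0), (0, -1))

/-- The product of two doubles is twice the double of the product, whence `z + z`. Tables for the
simple roots suffice, since these generate the rest. -/
lemma icosians_mul₀ : ∀ x ∈ icosians, ∃ z ∈ icosians, (qSimple 0).mul x = z + z := by
  decide +kernel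

lemma icosians_mul₁ : ∀ x ∈ icosians, ∃ z ∈ icosians, (qSimple 1).mul x = z + z := by
  decide +kernel

lemma icosians_mul₂ : ∀ x ∈ icosians, ∃ z ∈ icosians, (qSimple 2).mul x = z + z := by
  decide +kernel

lemma icosians_mul₃ : ∀ x ∈ icosians, ∃ z ∈ icosians, (qSimple 3).mul x = z + z := by
  decide +kernel

lemma icosians_mul_conj : ∀ x ∈ icosians, ∃ z ∈ icosians, qSimpleConj.mul x = z + z := by
  decide +kernel

/-- The absolute value of an integral approximation of a linear form that is positive on the simple
roots. -/
def QPhi.height : QPhi → ℕ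
  -- The form is `16 a + b + c + 5 d`, multiplied by 1000 with 1.618 in place of the golden ratio.
  | (a, b, c, d) => (1000 * (16 * a.1 + b.1 + c.1 + 5 * d.1) +
      1618 * (16 * a.2 + b.2 + c.2 + 5 * d.2)).natAbs

/-- The descent step showing that all 120 icosians are roots of the group generated by the four
simple reflections: the height drops until plus or minus a simple root is reached. -/
lemma icosians_reflect : ∀ x ∈ icosians, (∃ i, x = qSimple i) ∨ (∃ i, -x = qSimple i) ∨
    ∃ i, ((qSimple i).reflect x).height < x.height ∧ (qSimple i).reflect x ∈ icosians := by
  decide +kernel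

lemma icosians_reflect_pure : ∀ x ∈ icosians, x.1 = 0 → (∃ i : Fin 3, x = qSimple i.succ) ∨
    (∃ i : Fin 3, -x = qSimple i.succ) ∨
      ∃ i : Fin 3, ((qSimple i.succ).reflect x).height < x.height ∧
        (qSimple i.succ).reflect x ∈ icosians ∧ ((qSimple i.succ).reflect x).1 = 0 := by
  decide +kernel

/-- Orthogonal pure quaternions anticommute, so for `H₃` this supplies the root negated by an even
element of trace zero. -/
lemma icosians_orthogonal : ∀ x ∈ icosians, x.1 = 0 →
    ∃ y ∈ icosians, y.1 = 0 ∧ x.dot y = 0 := by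
  decide +kernel

/-- A unit icosian with a given real part. -/
def icosianRep (a : ZPhi) : QPhi := (icosians.find? fun x => x.1 = a).getD 0

/-- Conjugacy classes of the binary icosahedral group are separated by the real part. Comparing with
one representative per real part avoids a search over pairs. -/
lemma icosians_conj : ∀ x ∈ icosians, ∃ y ∈ icosians, x.mul y = y.mul (icosianRep x.1) := by
  decide +kernel

end Icosians

/-! ### Unit icosians as real quaternions: group structure and conjugacy -/

section Icosians

/-- The real number `a + b φ`. -/
def ZPhi.toReal (x : ZPhi) : ℝ := x.1 + x.2 * Real.goldenRatio

/-- Half of a quaternion with coordinates in `ZPhi`. -/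
def QPhi.toQuat : QPhi → Quaternion ℝ
  | (a, b, c, d) => ⟨a.toReal / 2, b.toReal / 2, c.toReal / 2, d.toReal / 2⟩

lemma ZPhi.toReal_mul (x y : ZPhi) : (x.mul y).toReal = x.toReal * y.toReal := by
  simp only [ZPhi.mul, ZPhi.toReal]
  push_cast
  linear_combination (-(x.2 * y.2 : ℝ)) * Real.goldenRatio_sq

lemma ZPhi.toReal_add (x y : ZPhi) : ZPhi.toReal (x + y) = x.toReal + y.toReal := by
  simp only [ZPhi.toReal, Prod.fst_add, Prod.snd_add]
  push_cast
  ring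

lemma ZPhi.toReal_neg (x : ZPhi) : ZPhi.toReal (-x) = -x.toReal := by
  simp only [ZPhi.toReal, Prod.fst_neg, Prod.snd_neg]
  push_cast
  ring

lemma ZPhi.toReal_sub (x y : ZPhi) : ZPhi.toReal (x - y) = x.toReal - y.toReal := by
  rw [sub_eq_add_neg, toReal_add, toReal_neg, sub_eq_add_neg]

/-- Irrationality of the golden ratio lets equalities of real parts be read as equalities of integer
pairs, as the finite verifications require. -/
lemma ZPhi.toReal_injective : Function.Injective ZPhi.toReal := by
  intro x y h
  simp only [ZPhi.toReal] at h
  by_cases h2 : x.2 = y.2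
  · rw [h2, add_left_inj] at h
    exact Prod.ext (by exact_mod_cast h) h2
  · exfalso
    have h3 : (x.2 - y.2 : ℝ) ≠ 0 := by
      rw [sub_ne_zero]; exact_mod_cast h2
    apply Real.goldenRatio_irrational
    refine ⟨(y.1 - x.1) / (x.2 - y.2), ?_⟩
    push_cast
    rw [div_eq_iff h3]
    linarith

@[simp] lemma QPhi.re_toQuat (a b c d : ZPhi) : (QPhi.toQuat (a, b, c, d)).re = a.toReal / 2 := rfl

@[simp] lemma QPhi.imI_toQuat (a b c d : ZPhi) :
    (QPhi.toQuat (a, b, c, d)).imI = b.toReal / 2 := rfl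

@[simp] lemma QPhi.imJ_toQuat (a b c d : ZPhi) :
    (QPhi.toQuat (a, b, c, d)).imJ = c.toReal / 2 := rfl

@[simp] lemma QPhi.imK_toQuat (a b c d : ZPhi) :
    (QPhi.toQuat (a, b, c, d)).imK = d.toReal / 2 := rfl

lemma QPhi.re_toQuat' (x : QPhi) : x.toQuat.re = x.1.toReal / 2 := rfl

lemma QPhi.toQuat_mul {x y z : QPhi} (h : x.mul y = z + z) : x.toQuat * y.toQuat = z.toQuat := by
  obtain ⟨a, b, c, d⟩ := x
  obtain ⟨e, f, g, k⟩ := y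
  obtain ⟨p, q, r, s⟩ := z
  simp only [QPhi.mul, Prod.mk_add_mk, Prod.mk.injEq] at h
  obtain ⟨h1, h2, h3, h4⟩ := h
  have h1 := congrArg ZPhi.toReal h1
  have h2 := congrArg ZPhi.toReal h2
  have h3 := congrArg ZPhi.toReal h3
  have h4 := congrArg ZPhi.toReal h4
  simp only [ZPhi.toReal_add, ZPhi.toReal_sub, ZPhi.toReal_mul] at h1 h2 h3 h4
  apply Quaternion.ext <;> simp only [Quaternion.re_mul, Quaternion.imI_mul, Quaternion.imJ_mul,
    Quaternion.imK_mul, QPhi.re_toQuat, QPhi.imI_toQuat, QPhi.imJ_toQuat,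
        QPhi.imK_toQuat] <;> linarith

lemma QPhi.toQuat_mul_eq {x y x' y' : QPhi} (h : x.mul y = x'.mul y') :
    x.toQuat * y.toQuat = x'.toQuat * y'.toQuat := by
  obtain ⟨a, b, c, d⟩ := x
  obtain ⟨e, f, g, k⟩ := y
  obtain ⟨a', b', c', d'⟩ := x'
  obtain ⟨e', f', g', k'⟩ := y'
  simp only [QPhi.mul, Prod.mk.injEq] at h
  obtain ⟨h1, h2, h3, h4⟩ := h
  have h1 := congrArg ZPhi.toReal h1
  have h2 := congrArg ZPhi.toReal h2
  have h3 := congrArg ZPhi.toReal h3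
  have h4 := congrArg ZPhi.toReal h4
  simp only [ZPhi.toReal_add, ZPhi.toReal_sub, ZPhi.toReal_mul] at h1 h2 h3 h4
  apply Quaternion.ext <;> simp only [Quaternion.re_mul, Quaternion.imI_mul, Quaternion.imJ_mul,
    Quaternion.imK_mul, QPhi.re_toQuat, QPhi.imI_toQuat, QPhi.imJ_toQuat,
        QPhi.imK_toQuat] <;> linarith

lemma QPhi.toQuat_neg (x : QPhi) : QPhi.toQuat (-x) = -x.toQuat := by
  obtain ⟨a, b, c, d⟩ := x
  apply Quaternion.ext <;> simp [ZPhi.toReal_neg, neg_div]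

lemma QPhi.inner_toQuat (x y : QPhi) : inner ℝ x.toQuat y.toQuat = (x.dot y).toReal / 4 := by
  obtain ⟨a, b, c, d⟩ := x
  obtain ⟨e, f, g, k⟩ := y
  simp only [Quaternion.inner_def, Quaternion.re_mul, QPhi.dot, QPhi.re_toQuat, QPhi.imI_toQuat,
    QPhi.imJ_toQuat, QPhi.imK_toQuat, ZPhi.toReal_add, ZPhi.toReal_mul,
    Quaternion.re_star, Quaternion.imI_star, Quaternion.imJ_star, Quaternion.imK_star]
  ring

lemma QPhi.toQuat_reflect (q x : QPhi) : (q.reflect x).toQuat = x.toQuat ∨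
    (q.reflect x).toQuat = x.toQuat - (2 * inner ℝ x.toQuat q.toQuat : ℝ) • q.toQuat := by
  simp only [QPhi.reflect]
  split_ifs with h
  · right
    rw [QPhi.inner_toQuat]
    have h1 := congrArg ZPhi.toReal h
    rw [ZPhi.toReal_add] at h1
    rw [h1]
    generalize ((x.dot q).1 / 2, (x.dot q).2 / 2) = c
    obtain ⟨a, b, c, d⟩ := x
    obtain ⟨e, f, g, k⟩ := q
    apply Quaternion.ext <;> simp [QPhi.smul, ZPhi.toReal_sub, ZPhi.toReal_mul] <;> ring
  · left; rfl

/-- The unit icosians. -/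
def unitIcosians : Set (Quaternion ℝ) := {x | ∃ y ∈ icosians, x = y.toQuat}

lemma icosians_dot : ∀ x ∈ icosians, x.dot x = (4, 0) := by decide +kernel

lemma inner_self_of_mem_unitIcosians {x : Quaternion ℝ} (hx : x ∈ unitIcosians) :
    inner ℝ x x = 1 := by
  obtain ⟨x, hx, rfl⟩ := hx
  rw [QPhi.inner_toQuat, icosians_dot x hx]
  norm_num [ZPhi.toReal]

lemma mul_star_of_mem_unitIcosians {x : Quaternion ℝ} (hx : x ∈ unitIcosians) :
    x * star x = 1 := by
  rw [Quaternion.self_mul_star, ← Quaternion.inner_self, inner_self_of_mem_unitIcosians hx]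
  rfl

lemma star_mul_of_mem_unitIcosians {x : Quaternion ℝ} (hx : x ∈ unitIcosians) :
    star x * x = 1 := by
  rw [Quaternion.star_mul_self, ← Quaternion.inner_self, inner_self_of_mem_unitIcosians hx]
  rfl

lemma one_mem_unitIcosians : 1 ∈ unitIcosians :=
  ⟨((2, 0), 0, 0, 0), by decide +kernel, by
    apply Quaternion.ext <;> norm_num [ZPhi.toReal] <;> rfl⟩

lemma qSimple_mem : ∀ i, qSimple i ∈ icosians := by decide +kernel

lemma qSimple_mem_unitIcosians (i : Fin 4) : (qSimple i).toQuat ∈ unitIcosians :=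
  ⟨_, qSimple_mem i, rfl⟩

lemma qSimple_mul_mem {x : Quaternion ℝ} (hx : x ∈ unitIcosians) (i : Fin 4) :
    (qSimple i).toQuat * x ∈ unitIcosians := by
  obtain ⟨x, hx, rfl⟩ := hx
  have key : ∀ i, ∃ z ∈ icosians, (qSimple i).mul x = z + z := by
    intro i
    fin_cases i
    exacts [icosians_mul₀ x hx, icosians_mul₁ x hx, icosians_mul₂ x hx, icosians_mul₃ x hx]
  obtain ⟨z, hz, h⟩ := key i
  exact ⟨z, hz, QPhi.toQuat_mul h⟩

lemma neg_star_qSimple_succ (i : Fin 3) :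
    -star (qSimple i.succ).toQuat = (qSimple i.succ).toQuat := by
  have h : (qSimple i.succ).toQuat.re = 0 := by
    rw [QPhi.re_toQuat']
    have : (qSimple i.succ).1 = 0 := by revert i; decide
    rw [this]; norm_num [ZPhi.toReal]
  apply Quaternion.ext <;> simp [h]

lemma neg_star_qSimple_zero : -star (qSimple 0).toQuat = qSimpleConj.toQuat := by
  apply Quaternion.ext <;> simp [qSimple, qSimpleConj, ZPhi.toReal]; ring

lemma neg_star_qSimple_mul_mem {x : Quaternion ℝ} (hx : x ∈ unitIcosians) (i : Fin 4) :
    -star (qSimple i).toQuat * x ∈ unitIcosians := by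
  refine Fin.cases ?_ (fun j => ?_) i
  · obtain ⟨x, hx, rfl⟩ := hx
    obtain ⟨z, hz, h⟩ := icosians_mul_conj x hx
    exact ⟨z, hz, by rw [neg_star_qSimple_zero]; exact QPhi.toQuat_mul h⟩
  · rw [neg_star_qSimple_succ]
    exact qSimple_mul_mem hx _

/-- For a simple root `q`, multiplying by `-star q` and then by `q` gives `-x`. -/
lemma neg_mem_unitIcosians {x : Quaternion ℝ} (hx : x ∈ unitIcosians) : -x ∈ unitIcosians := by
  have h := qSimple_mul_mem (neg_star_qSimple_mul_mem hx 0) 0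
  rwa [← mul_assoc, mul_neg, mul_star_of_mem_unitIcosians (qSimple_mem_unitIcosians 0), neg_mul,
    one_mul] at h

lemma pairOf_mem_unitIcosians (l : List (Fin 4)) :
    (pairOf (l.map fun i => (qSimple i).toQuat)).1 ∈ unitIcosians ∧
      (pairOf (l.map fun i => (qSimple i).toQuat)).2 ∈ unitIcosians := by
  induction l with
  | nil => exact ⟨one_mem_unitIcosians, one_mem_unitIcosians⟩
  | cons i l ih =>
    exact ⟨qSimple_mul_mem ih.2 i, neg_star_qSimple_mul_mem ih.1 i⟩

lemma reflection_reflection {q : Quaternion ℝ} (hq : inner ℝ q q = 1) (x : Quaternion ℝ) :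
    x - (2 * inner ℝ x q : ℝ) • q -
      (2 * inner ℝ (x - (2 * inner ℝ x q : ℝ) • q) q : ℝ) • q = x := by
  rw [inner_sub_left, real_inner_smul_left, hq]
  module

/-- Every unit icosian is obtained from the simple roots of type `H₄` by simple reflections. -/
lemma unitIcosians_induction {C : Quaternion ℝ → Prop} (h₁ : ∀ i, C (qSimple i).toQuat)
    (h₂ : ∀ i, C (-(qSimple i).toQuat))
    (h₃ : ∀ i x, C x → C (x - (2 * inner ℝ x (qSimple i).toQuat : ℝ) • (qSimple i).toQuat))
    {x : Quaternion ℝ} (hx : x ∈ unitIcosians) : C x := by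
  obtain ⟨x, hx, rfl⟩ := hx
  induction hn : x.height using Nat.strong_induction_on generalizing x with
  | _ n ih =>
    rcases icosians_reflect x hx with ⟨i, rfl⟩ | ⟨i, hi⟩ | ⟨i, hlt, hmem⟩
    · exact h₁ i
    · rw [← neg_neg x, hi, QPhi.toQuat_neg]
      exact h₂ i
    · have h := ih _ (hn ▸ hlt) _ hmem rfl
      rcases QPhi.toQuat_reflect (qSimple i) x with h' | h'
      · rwa [h'] at h
      · rw [h'] at h
        have := h₃ i _ h
        rwa [reflection_reflection (inner_self_of_mem_unitIcosians
          (qSimple_mem_unitIcosians i))] at this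

/-- Every pure unit icosian is obtained from the simple roots of type `H₃` by simple
reflections. -/
lemma unitIcosians_induction_pure {C : Quaternion ℝ → Prop}
    (h₁ : ∀ i : Fin 3, C (qSimple i.succ).toQuat)
    (h₂ : ∀ i : Fin 3, C (-(qSimple i.succ).toQuat))
    (h₃ : ∀ (i : Fin 3) x, C x →
      C (x - (2 * inner ℝ x (qSimple i.succ).toQuat : ℝ) • (qSimple i.succ).toQuat))
    {x : QPhi} (hx : x ∈ icosians) (hx0 : x.1 = 0) : C x.toQuat := by
  induction hn : x.height using Nat.strong_induction_on generalizing x with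
  | _ n ih =>
    rcases icosians_reflect_pure x hx hx0 with ⟨i, rfl⟩ | ⟨i, hi⟩ | ⟨i, hlt, hmem, h0⟩
    · exact h₁ i
    · rw [← neg_neg x, hi, QPhi.toQuat_neg]
      exact h₂ i
    · have h := ih _ (hn ▸ hlt) hmem h0 rfl
      rcases QPhi.toQuat_reflect (qSimple i.succ) x with h' | h'
      · rwa [h'] at h
      · rw [h'] at h
        have := h₃ i _ h
        rwa [reflection_reflection (inner_self_of_mem_unitIcosians
          (qSimple_mem_unitIcosians _))] at this

/-- Twice the inner product is `x * star q + q * star x`; multiply this by `q` on the right and use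
`star q * q = 1`. -/
lemma reflection_eq_mul {q : Quaternion ℝ} (hq : inner ℝ q q = 1) (x : Quaternion ℝ) :
    x - (2 * inner ℝ x q : ℝ) • q = -(q * star x * q) := by
  have h1 : x * star q + q * star x = ((2 * inner ℝ x q : ℝ) : Quaternion ℝ) := by
    rw [Quaternion.inner_def]
    apply Quaternion.ext <;> simp <;> ring
  have h2 : star q * q = 1 := by
    rw [Quaternion.star_mul_self, ← Quaternion.inner_self, hq]; rfl
  have h3 : q * star x = ((2 * inner ℝ x q : ℝ) : Quaternion ℝ) - x * star q :=
    eq_sub_of_add_eq' h1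
  rw [h3, sub_mul, mul_assoc, h2, mul_one, neg_sub, Quaternion.coe_mul_eq_smul]

/-- Induction along simple reflections: a reflection replaces `x` by `-(q * star x * q)`, so closure
under left multiplication by `x` and by `star x` must be carried together. -/
lemma mul_mem_unitIcosians {x : Quaternion ℝ} (hx : x ∈ unitIcosians) : ∀ y ∈ unitIcosians,
    x * y ∈ unitIcosians ∧ star x * y ∈ unitIcosians := by
  have h₀ : ∀ i, ∀ y ∈ unitIcosians, star (qSimple i).toQuat * y ∈ unitIcosians := by
    intro i y hy
    have := neg_mem_unitIcosians (neg_star_qSimple_mul_mem hy i)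
    rwa [neg_mul, neg_neg] at this
  refine unitIcosians_induction (C := fun x => ∀ y ∈ unitIcosians,
    x * y ∈ unitIcosians ∧ star x * y ∈ unitIcosians) ?_ ?_ ?_ hx
  · exact fun i y hy => ⟨qSimple_mul_mem hy i, h₀ i y hy⟩
  · intro i y hy
    rw [star_neg, neg_mul, neg_mul]
    exact ⟨neg_mem_unitIcosians (qSimple_mul_mem hy i), neg_mem_unitIcosians (h₀ i y hy)⟩
  · intro i x h y hy
    rw [reflection_eq_mul (inner_self_of_mem_unitIcosians (qSimple_mem_unitIcosians i))]
    simp only [star_neg, star_mul, star_star, neg_mul, mul_assoc]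
    exact ⟨neg_mem_unitIcosians (qSimple_mul_mem (h _ (qSimple_mul_mem hy i)).2 i),
      neg_mem_unitIcosians (h₀ i _ (h _ (h₀ i y hy)).1)⟩

lemma exists_conj_unitIcosians {x : QPhi} (hx : x ∈ icosians) :
    ∃ y ∈ unitIcosians, x.toQuat * y = y * (icosianRep x.1).toQuat := by
  obtain ⟨y, hy, h⟩ := icosians_conj x hx
  exact ⟨_, ⟨y, hy, rfl⟩, QPhi.toQuat_mul_eq h⟩

/-- Unit icosians with opposite real parts are conjugate up to sign. -/
lemma exists_mul_eq_neg_mul {a b : Quaternion ℝ} (ha : a ∈ unitIcosians) (hb : b ∈ unitIcosians)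
    (h : a.re + b.re = 0) : ∃ x ∈ unitIcosians, a * x = -(x * b) := by
  obtain ⟨b', hb', hbb⟩ := neg_mem_unitIcosians hb
  obtain ⟨a', ha', rfl⟩ := ha
  obtain ⟨y, hy, hay⟩ := exists_conj_unitIcosians ha'
  obtain ⟨z, hz, hbz⟩ := exists_conj_unitIcosians hb'
  have h1 : a'.1 = b'.1 := by
    apply ZPhi.toReal_injective
    have := congrArg (·.re) hbb
    simp only [Quaternion.re_neg, QPhi.re_toQuat'] at this h
    linarith
  rw [h1] at hay
  rw [← hbb] at hbz
  have hs : star z ∈ unitIcosians := by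
    simpa using (mul_mem_unitIcosians hz 1 one_mem_unitIcosians).2
  -- `y` conjugates `a`, and `z` conjugates `-b`, to the representative of their common real part;
  -- so `y * star z` intertwines `a` with `-b`.
  refine ⟨y * star z, (mul_mem_unitIcosians hy _ hs).1, ?_⟩
  have h2 : star z * -b = (icosianRep b'.1).toQuat * star z := by
    calc star z * -b = star z * (-b * z) * star z := by
          rw [mul_assoc, mul_assoc (-b), mul_star_of_mem_unitIcosians hz, mul_one]
      _ = _ := by rw [hbz, ← mul_assoc (star z) z, star_mul_of_mem_unitIcosians hz, one_mul]
  rw [← mul_neg, mul_assoc y, h2, ← mul_assoc, ← mul_assoc, hay]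

/-- A pure unit icosian anticommutes with some pure unit icosian. -/
lemma exists_mul_eq_neg_mul_pure {a : Quaternion ℝ} (ha : a ∈ unitIcosians) (h : a.re = 0) :
    ∃ x ∈ icosians, x.1 = 0 ∧ a * x.toQuat = -(x.toQuat * a) := by
  obtain ⟨a, ha, rfl⟩ := ha
  have h0 : a.1 = 0 := by
    apply ZPhi.toReal_injective
    rw [QPhi.re_toQuat'] at h
    norm_num [ZPhi.toReal] at h ⊢
    exact h
  obtain ⟨x, hx, hx0, hax⟩ := icosians_orthogonal a ha h0
  refine ⟨x, hx, hx0, ?_⟩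
  have h1 : inner ℝ a.toQuat x.toQuat = 0 := by
    rw [QPhi.inner_toQuat, hax]; norm_num [ZPhi.toReal]
  have h2 : x.toQuat.re = 0 := by rw [QPhi.re_toQuat', hx0]; norm_num [ZPhi.toReal]
  rw [Quaternion.inner_def] at h1
  simp [h, h2] at h1
  apply Quaternion.ext <;> simp [h, h2]; all_goals linarith

end Icosians

/-! ### Surjectivity for `H₃` and `H₄` -/

section ExceptionalTypes

open Quaternion

variable {E : Type*} [NormedAddCommGroup E] [InnerProductSpace ℝ E]

lemma IsReflectionIn.neg {r : E ≃ₗ[ℝ] E} {v : E} (h : IsReflectionIn r v) :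
    IsReflectionIn r (-v) where
  inner_self := by rw [inner_neg_neg, h.inner_self]
  apply_eq x := by rw [h.apply_eq, inner_neg_right]; module

lemma IsReflectionIn.inner_map_map {r : E ≃ₗ[ℝ] E} {v : E} (h : IsReflectionIn r v) (x y : E) :
    inner ℝ (r x) (r y) = inner ℝ x y := by
  rw [h.apply_eq, h.apply_eq]
  simp only [inner_sub_left, inner_sub_right, real_inner_smul_left, real_inner_smul_right,
    h.inner_self, real_inner_comm v y]
  ring

lemma IsReflectionIn.conj {r : E ≃ₗ[ℝ] E} {v : E} (h : IsReflectionIn r v) {g : E ≃ₗ[ℝ] E}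
    (hg : ∀ x y, inner ℝ (g x) (g y) = inner ℝ x y) : IsReflectionIn (g * r * g⁻¹) (g v) where
  inner_self := by rw [hg, h.inner_self]
  apply_eq x := by
    obtain ⟨y, rfl⟩ := g.surjective x
    have : g⁻¹ (g y) = y := g.symm_apply_apply y
    rw [LinearEquiv.mul_apply, LinearEquiv.mul_apply, this, h.apply_eq, hg, map_sub, map_smul]

section

variable {θ : E →ₗ[ℝ] ℍ[ℝ]} (hθ : ∀ v, normSq (θ v) = inner ℝ v v)

include hθ in
lemma inner_of_normSq (v w : E) : inner ℝ (θ v) (θ w) = inner ℝ v w := by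
  have h := hθ (v + w)
  rw [← Quaternion.inner_self, map_add, real_inner_add_add_self, real_inner_add_add_self,
    Quaternion.inner_self, Quaternion.inner_self, hθ, hθ] at h
  linarith

include hθ in
lemma injective_of_normSq : Function.Injective θ := by
  rw [injective_iff_map_eq_zero]
  intro v hv
  rw [← inner_self_eq_zero (𝕜 := ℝ), ← hθ, hv, map_zero]

end

/-- The unit vectors `θ β` for which the reflection in `β` belongs to `W`. -/
def rootImages (θ : E →ₗ[ℝ] ℍ[ℝ]) (W : Subgroup (E ≃ₗ[ℝ] E)) : Set ℍ[ℝ] :=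
  {x | ∃ β, θ β = x ∧ ∃ r ∈ W, IsReflectionIn r β}

variable {θ : E →ₗ[ℝ] ℍ[ℝ]} (hθ : ∀ v, normSq (θ v) = inner ℝ v v)
  {W : Subgroup (E ≃ₗ[ℝ] E)}

lemma neg_mem_rootImages {x : ℍ[ℝ]} (hx : x ∈ rootImages θ W) : -x ∈ rootImages θ W := by
  obtain ⟨β, rfl, r, hr, h⟩ := hx
  exact ⟨-β, map_neg _ _, r, hr, h.neg⟩

include hθ in
lemma reflection_mem_rootImages {q x : ℍ[ℝ]} (hq : q ∈ rootImages θ W) (hx : x ∈ rootImages θ W) :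
    x - (2 * inner ℝ x q : ℝ) • q ∈ rootImages θ W := by
  obtain ⟨β, rfl, r, hr, h⟩ := hx
  obtain ⟨γ, rfl, s, hs, h'⟩ := hq
  refine ⟨s β, ?_, s * r * s⁻¹, W.mul_mem (W.mul_mem hs hr) (W.inv_mem hs),
    h.conj h'.inner_map_map⟩
  rw [h'.apply_eq, map_sub, map_smul, inner_of_normSq hθ]

include hθ in
/-- The group contains `-1` if it contains the reflections in `i`, `j`, `k` and, unless all vectors
are pure, the reflection in `1`. -/
lemma neg_mem_of_rootImages
    (h₁ : QPhi.toQuat ((2, 0), 0, 0, 0) ∈ rootImages θ W ∨ ∀ v, (θ v).re = 0)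
    (hi : QPhi.toQuat (0, (2, 0), 0, 0) ∈ rootImages θ W)
        (hj : QPhi.toQuat (0, 0, (2, 0), 0) ∈ rootImages θ W)
    (hk : QPhi.toQuat (0, 0, 0, (2, 0)) ∈ rootImages θ W) : LinearEquiv.neg ℝ ∈ W := by
  have key : ∀ {v β : E} {r : E ≃ₗ[ℝ] E}, IsReflectionIn r β →
      θ (r v) = θ v - (2 * inner ℝ (θ v) (θ β) : ℝ) • θ β := by
    intro v β r h
    rw [h.apply_eq, map_sub, map_smul, inner_of_normSq hθ]
  obtain ⟨βi, hi, ri, hri, hi'⟩ := hi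
  obtain ⟨βj, hj, rj, hrj, hj'⟩ := hj
  obtain ⟨βk, hk, rk, hrk, hk'⟩ := hk
  -- The reflections in `i`, `j`, `k` compose to quaternion conjugation. This is already -1 on pure
  -- quaternions; otherwise the reflection in 1 completes it to -1.
  have hijk : ∀ v, θ (ri (rj (rk v))) = star (θ v) := by
    intro v
    rw [key hi', key hj', key hk', hi, hj, hk]
    apply Quaternion.ext <;> simp [Quaternion.inner_def, ZPhi.toReal] <;> ring
  rcases h₁ with ⟨β, hβ, r, hr, h⟩ | h₁
  · convert W.mul_mem hr (W.mul_mem hri (W.mul_mem hrj hrk)) using 1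
    ext v
    apply injective_of_normSq hθ
    change θ (-v) = θ (r (ri (rj (rk v))))
    rw [key h, hijk, hβ]
    apply Quaternion.ext <;> simp [Quaternion.inner_def, ZPhi.toReal]
    ring
  · convert W.mul_mem hri (W.mul_mem hrj hrk) using 1
    ext v
    apply injective_of_normSq hθ
    change θ (-v) = θ (ri (rj (rk v)))
    rw [hijk]
    apply Quaternion.ext <;> simp [h₁]

lemma mem_icosians_units : (((2, 0), 0, 0, 0) : QPhi) ∈ icosians ∧
    ((0, (2, 0), 0, 0) : QPhi) ∈ icosians ∧
    ((0, 0, (2, 0), 0) : QPhi) ∈ icosians ∧ ((0, 0, 0, (2, 0)) : QPhi) ∈ icosians := by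
  refine ⟨?_, ?_, ?_, ?_⟩ <;> decide +kernel

variable [FiniteDimensional ℝ E] [Finite W] (S : Type) [AddCommGroup S] [Module ℂ S]
  [Module (ClC E) S] [IsScalarTower ℂ (ClC E) S] [IsSimpleModule (ClC E) S] [Module.Finite ℂ S]

include hθ in
/-- Surjectivity for a group of type `H₄`. -/
theorem exists_spinMap_eq_of_icosians {s : Fin 4 → E ≃ₗ[ℝ] E} {u : Fin 4 → E}
    (hs : ∀ i, IsReflectionIn (s i) (u i)) (hW : W = Subgroup.closure (Set.range s))
    (hu : ∀ i, θ (u i) = (qSimple i).toQuat) {y : RepRing (cover W)}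
    (hy : y ∈ genuinePart (coverMap W)) : ∃ σ, spinMap W S σ = y := by
  have hsW : ∀ i, s i ∈ W := fun i => by rw [hW]; exact Subgroup.subset_closure ⟨i, rfl⟩
  have hq : ∀ i, (qSimple i).toQuat ∈ rootImages θ W := fun i => ⟨u i, hu i, s i, hsW i, hs i⟩
  -- Every unit icosian is a root, so the intertwiner between `a` and `-b` found below is one too.
  have hroot : unitIcosians ⊆ rootImages θ W := fun x hx =>
    unitIcosians_induction (C := fun x => x ∈ rootImages θ W) hq
      (fun i => neg_mem_rootImages (hq i))
      (fun i x h => reflection_mem_rootImages hθ (hq i) h) hx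
  obtain ⟨h0, h1, h2, h3⟩ := mem_icosians_units
  have hneg : LinearEquiv.neg ℝ ∈ W :=
    neg_mem_of_rootImages hθ (Or.inl (hroot ⟨_, h0, rfl⟩)) (hroot ⟨_, h1, rfl⟩)
      (hroot ⟨_, h2, rfl⟩) (hroot ⟨_, h3, rfl⟩)
  refine exists_spinMap_eq hθ S hs hW hneg (fun l _ => ?_) hy
  simp only [hu]
  obtain ⟨ha, hb⟩ := pairOf_mem_unitIcosians l
  refine or_iff_not_imp_left.mpr fun h => ?_
  obtain ⟨x, hx, hab⟩ := exists_mul_eq_neg_mul ha hb (not_not.mp h)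
  obtain ⟨β, rfl, r, hr, h'⟩ := hroot hx
  exact ⟨β, r, hr, h', hab⟩

include hθ in
/-- Surjectivity for a group of type `H₃`. -/
theorem exists_spinMap_eq_of_icosians_pure {s : Fin 3 → E ≃ₗ[ℝ] E} {u : Fin 3 → E}
    (hs : ∀ i, IsReflectionIn (s i) (u i)) (hW : W = Subgroup.closure (Set.range s))
    (hu : ∀ i, θ (u i) = (qSimple i.succ).toQuat) (hre : ∀ v, (θ v).re = 0)
    {y : RepRing (cover W)} (hy : y ∈ genuinePart (coverMap W)) : ∃ σ, spinMap W S σ = y := by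
  have hsW : ∀ i, s i ∈ W := fun i => by rw [hW]; exact Subgroup.subset_closure ⟨i, rfl⟩
  have hq : ∀ i : Fin 3, (qSimple i.succ).toQuat ∈ rootImages θ W :=
    fun i => ⟨u i, hu i, s i, hsW i, hs i⟩
  have hroot : ∀ x ∈ icosians, x.1 = 0 → x.toQuat ∈ rootImages θ W := fun x hx hx0 =>
    unitIcosians_induction_pure (C := fun x => x ∈ rootImages θ W) hq
      (fun i => neg_mem_rootImages (hq i))
      (fun i x h => reflection_mem_rootImages hθ (hq i) h) hx hx0
  obtain ⟨-, h1, h2, h3⟩ := mem_icosians_units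
  have hneg : LinearEquiv.neg ℝ ∈ W :=
    neg_mem_of_rootImages hθ (Or.inr hre) (hroot _ h1 rfl)
      (hroot _ h2 rfl) (hroot _ h3 rfl)
  -- A pure `q` satisfies `-star q = q`, so both entries of the pair are the same product.
  have heq : ∀ l : List (Fin 3),
      (pairOf (l.map fun i => θ (u i))).1 = (pairOf (l.map fun i => θ (u i))).2 := by
    intro l
    induction l with
    | nil => rfl
    | cons i l ih =>
      simp only [hu] at ih ⊢
      simp only [List.map_cons, pairOf, ih, neg_star_qSimple_succ]
  refine exists_spinMap_eq hθ S hs hW hneg (fun l _ => ?_) hy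
  have ha := (pairOf_mem_unitIcosians (l.map Fin.succ)).1
  rw [List.map_map, show ((fun i => (qSimple i).toQuat) ∘ Fin.succ) = fun i : Fin 3 => θ (u i)
    from funext fun i => (hu i).symm] at ha
  rw [← heq l]
  refine or_iff_not_imp_left.mpr fun h => ?_
  obtain ⟨x, hx, hx0, hab⟩ := exists_mul_eq_neg_mul_pure ha (by linarith [not_not.mp h])
  obtain ⟨β, hβ, r, hr, h'⟩ := hroot x hx hx0
  exact ⟨β, r, hr, h', by rw [hβ, hab]⟩

end ExceptionalTypes

/-! ### Dihedral groups -/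

section DihedralTypes

open Quaternion

/-- Quaternions in the span of 1 and `i` commute, so the second entry is the conjugate of the first
up to the sign collected from the factors `-star q`. -/
lemma pairOf_of_planar {l : List ℍ[ℝ]} (hl : ∀ q ∈ l, q.imJ = 0 ∧ q.imK = 0) :
    (pairOf l).1.imJ = 0 ∧ (pairOf l).1.imK = 0 ∧
      (pairOf l).2 = (-1 : ℝ) ^ l.length • star (pairOf l).1 := by
  induction l with
  | nil => simp [pairOf]
  | cons q l ih =>
    obtain ⟨h1, h2, h3⟩ := ih fun q hq => hl q (List.mem_cons_of_mem _ hq)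
    obtain ⟨h4, h5⟩ := hl q List.mem_cons_self
    simp only [pairOf, h3, List.length_cons, pow_succ]
    have h6 := neg_one_pow_eq_or ℝ l.length
    generalize (-1 : ℝ) ^ l.length = c at h6
    have hc : c * c = 1 := by rcases h6 with rfl | rfl <;> norm_num
    refine ⟨by simp [h1, h2, h4, h5], by simp [h1, h2, h4, h5], ?_⟩
    have h7 : q * (pairOf l).1 = (pairOf l).1 * q := by
      apply Quaternion.ext <;> simp [h1, h2, h4, h5] <;> ring
    have h8 : star q * (pairOf l).1 = (pairOf l).1 * star q := by
      apply Quaternion.ext <;> simp [h1, h2, h4, h5] <;> ring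
    rw [mul_smul_comm, Quaternion.star_smul, smul_smul, star_mul, star_star, ← h8, neg_mul,
      mul_neg_one, neg_mul, hc, neg_one_smul]

variable {E : Type*} [NormedAddCommGroup E] [InnerProductSpace ℝ E]

/-- An isometric embedding of a plane into the quaternions. -/
lemma exists_planar_embedding (hE : Module.finrank ℝ E = 2) : ∃ θ : E →ₗ[ℝ] ℍ[ℝ],
    (∀ v, normSq (θ v) = inner ℝ v v) ∧ ∀ v, (θ v).imJ = 0 ∧ (θ v).imK = 0 := by
  have : FiniteDimensional ℝ E := Module.finite_of_finrank_pos (by omega)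
  let b := (stdOrthonormalBasis ℝ E).reindex (finCongr hE)
  refine ⟨(innerₗ E (b 0)).smulRight (1 : ℍ[ℝ]) +
    (innerₗ E (b 1)).smulRight (QPhi.toQuat (0, (2, 0), 0, 0)), fun v => ?_, fun v => ?_⟩
  · rw [← b.sum_inner_mul_inner v v, Fin.sum_univ_two, Quaternion.normSq_def']
    simp [ZPhi.toReal, real_inner_comm (b 0) v, real_inner_comm (b 1) v]
    ring
  · simp [ZPhi.toReal]

section

variable {s : Fin 2 → E ≃ₗ[ℝ] E} {u : Fin 2 → E} (hs : ∀ i, IsReflectionIn (s i) (u i))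

include hs in
/-- A product of an even number of reflections of a plane is given by a multiplication. -/
lemma exists_rotation {θ : E →ₗ[ℝ] ℍ[ℝ]} (hθ : ∀ v, normSq (θ v) = inner ℝ v v)
    (hpl : ∀ v, (θ v).imJ = 0 ∧ (θ v).imK = 0) {l : List (Fin 2)} (hl : Even l.length) :
    ∃ c : ℍ[ℝ], ∀ v, θ ((l.map s).prod v) = c * θ v := by
  obtain ⟨h1, h2, h3⟩ := pairOf_of_planar (l := l.map fun i => θ (u i)) (by
    intro q hq
    obtain ⟨i, -, rfl⟩ := List.mem_map.mp hq
    exact hpl _)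
  have h4 := (normSq_pairOf (l := l.map fun i => θ (u i)) (by
    intro q hq
    obtain ⟨i, -, rfl⟩ := List.mem_map.mp hq
    rw [hθ, (hs i).inner_self])).1
  rw [List.length_map, hl.neg_one_pow, one_smul] at h3
  have h5 := pairOf_mul hθ hs l hl
  rw [h3] at h5
  generalize (pairOf (l.map fun i => θ (u i))).1 = a at *
  -- Here `θ (w v) * star a = a * θ v`; since `a` is a unit commuting with `θ v`, this gives `θ (w
  -- v) = a ^ 2 * θ v`.
  refine ⟨a * a, fun v => ?_⟩
  have h6 : star a * a = 1 := by rw [Quaternion.star_mul_self, h4]; rfl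
  rw [← mul_one (θ ((l.map s).prod v)), ← h6, ← mul_assoc, ← h5, mul_assoc, mul_assoc]
  congr 1
  have := hpl v
  apply Quaternion.ext <;> simp [h1, h2, this] <;> ring

include hs in
/-- A rotation of the plane of order two is `-1`. -/
lemma eq_neg_of_mul_self (hE : Module.finrank ℝ E = 2) {l : List (Fin 2)} (hl : Even l.length)
    (h1 : (l.map s).prod ≠ 1) (h2 : (l.map s).prod * (l.map s).prod = 1) :
    (l.map s).prod = LinearEquiv.neg ℝ := by
  obtain ⟨θ, hθ, hpl⟩ := exists_planar_embedding hE
  obtain ⟨c, hc⟩ := exists_rotation hs hθ hpl hl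
  have h3 : c * c * θ (u 0) = θ (u 0) := by
    rw [mul_assoc, ← hc, ← hc, ← LinearEquiv.mul_apply, h2]; rfl
  have h4 : θ (u 0) ≠ 0 := by
    rw [← Quaternion.normSq_ne_zero, hθ, (hs 0).inner_self]; exact one_ne_zero
  have h5 : c * c = 1 := by
    rw [mul_eq_right₀ h4] at h3; exact h3
  rcases mul_self_eq_one_iff.mp h5 with rfl | rfl
  · exact absurd (LinearEquiv.ext fun v => injective_of_normSq hθ (by rw [hc, one_mul]; rfl)) h1
  · exact LinearEquiv.ext fun v => injective_of_normSq hθ (by rw [hc]; simp)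

include hs in
/-- A rotation of the plane that takes a root to its negative is `-1`. -/
lemma eq_neg_of_apply_eq_neg (hE : Module.finrank ℝ E = 2) {l : List (Fin 2)} (hl : Even l.length)
    (h : (l.map s).prod (u 0) = -u 0) : (l.map s).prod = LinearEquiv.neg ℝ := by
  obtain ⟨θ, hθ, hpl⟩ := exists_planar_embedding hE
  obtain ⟨c, hc⟩ := exists_rotation hs hθ hpl hl
  have h4 : θ (u 0) ≠ 0 := by
    rw [← Quaternion.normSq_ne_zero, hθ, (hs 0).inner_self]; exact one_ne_zero
  have h3 := hc (u 0)
  rw [h, map_neg, ← neg_one_mul, mul_left_inj' h4] at h3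
  exact LinearEquiv.ext fun v => injective_of_normSq hθ (by rw [hc, ← h3]; simp)

-- This places every rotation of the group, in particular -1 if it occurs, in the cyclic group
-- generated by `s 0 * s 1`, whose order decides whether -1 can occur.
include hs in
lemma prod_mem_zpowers (l : List (Fin 2)) :
    (Even l.length → (l.map s).prod ∈ Subgroup.zpowers (s 0 * s 1)) ∧
      (¬ Even l.length → s 0 * (l.map s).prod ∈ Subgroup.zpowers (s 0 * s 1)) := by
  have hR := Subgroup.mem_zpowers (s 0 * s 1)
  induction l with
  | nil => simp
  | cons i l ih =>
    simp only [List.length_cons, Nat.even_add_one, not_not, List.map_cons, List.prod_cons]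
    refine ⟨fun h => ?_, fun h => ?_⟩
    · have h' := ih.2 h
      fin_cases i
      · exact h'
      · convert mul_mem (inv_mem hR) h' using 1
        rw [mul_inv_rev, (hs 0).inv_eq, (hs 1).inv_eq, mul_assoc, ← mul_assoc (s 0) (s 0),
          (hs 0).mul_self, one_mul]; rfl
    · have h' := ih.1 h
      fin_cases i
      · rw [← mul_assoc]
        change s 0 * s 0 * _ ∈ _
        rwa [(hs 0).mul_self, one_mul]
      · rw [← mul_assoc]
        exact mul_mem hR h'

variable {W : Subgroup (E ≃ₗ[ℝ] E)} [Finite W] (S : Type) [AddCommGroup S] [Module ℂ S]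
  [Module (ClC E) S] [IsScalarTower ℂ (ClC E) S] [Module.Finite ℂ S]

include hs in
/-- Surjectivity for a dihedral group whose rotation subgroup has even order. -/
theorem exists_spinMap_eq_of_even [IsSimpleModule (ClC E) S] (hE : Module.finrank ℝ E = 2)
    (hW : W = Subgroup.closure (Set.range s))
    (h0 : orderOf (s 0 * s 1) ≠ 0) (hn : Even (orderOf (s 0 * s 1)))
    {y : RepRing (cover W)} (hy : y ∈ genuinePart (coverMap W)) : ∃ σ, spinMap W S σ = y := by
  have : FiniteDimensional ℝ E := Module.finite_of_finrank_pos (by omega)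
  have hsW : ∀ i, s i ∈ W := fun i => by rw [hW]; exact Subgroup.subset_closure ⟨i, rfl⟩
  have hneg : LinearEquiv.neg ℝ ∈ W := by
    obtain ⟨k, hk⟩ := hn
    obtain ⟨l, hl, hlp⟩ : ∃ l : List (Fin 2), Even l.length ∧ (l.map s).prod = (s 0 * s 1) ^ k := by
      clear hk h0
      induction k with
      | zero => exact ⟨[], by simp⟩
      | succ k ih =>
        obtain ⟨l, hl, h⟩ := ih
        exact ⟨0 :: 1 :: l, by simpa [Nat.even_add_one] using hl,
          by simp [h, pow_succ', mul_assoc]⟩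
    -- With order `k + k`, the power `(s 0 * s 1) ^ k` is the rotation of order two.
    rw [← eq_neg_of_mul_self hs hE hl, hlp]
    · exact pow_mem (mul_mem (hsW 0) (hsW 1)) k
    · rw [hlp]
      intro h
      have := orderOf_dvd_of_pow_eq_one h
      have := Nat.le_of_dvd (by omega) this
      omega
    · rw [hlp, ← pow_add, ← hk, pow_orderOf_eq_one]
  obtain ⟨θ, hθ, hpl⟩ := exists_planar_embedding hE
  refine exists_spinMap_eq hθ S hs hW hneg (fun l hl => ?_) hy
  obtain ⟨h1, h2, h3⟩ := pairOf_of_planar (l := l.map fun i => θ (u i)) (by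
    intro q hq
    obtain ⟨i, -, rfl⟩ := List.mem_map.mp hq
    exact hpl _)
  rw [List.length_map, hl.neg_one_pow, one_smul] at h3
  rw [h3]
  generalize (pairOf (l.map fun i => θ (u i))).1 = a at *
  -- Trace zero makes `a` imaginary, so `star a = -a`; as `a` commutes with planar quaternions, any
  -- root would do.
  refine or_iff_not_imp_left.mpr fun h => ⟨u 0, s 0, hsW 0, hs 0, ?_⟩
  have h4 : a.re = 0 := by
    have := not_not.mp h
    rw [Quaternion.re_star] at this
    linarith
  have := hpl (u 0)
  apply Quaternion.ext <;> simp [h1, h2, h4, this] <;> ring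

-- A unit vector `e` orthogonal to `v` anticommutes with it, so evaluating the trace of `v * e * e`
-- directly and after cyclic rotation gives opposite values.
omit [Module.Finite ℂ S] in
lemma clTrace_clι_eq_zero (hE : 1 < Module.finrank ℝ E) (v : E) : clTrace S (clι v) = 0 := by
  have : FiniteDimensional ℝ E := Module.finite_of_finrank_pos (by omega)
  obtain ⟨e, he, he1⟩ : ∃ e : E, inner ℝ e v = 0 ∧ inner ℝ e e = (1 : ℝ) := by
    have h : (ℝ ∙ v)ᗮ ≠ ⊥ := by
      intro h
      have h1 := (ℝ ∙ v).finrank_add_finrank_orthogonal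
      rw [h, finrank_bot] at h1
      have := finrank_span_le_card (R := ℝ) ({v} : Set E)
      rw [Set.toFinset_singleton, Finset.card_singleton] at this
      omega
    obtain ⟨e, he, h0⟩ := Submodule.exists_mem_ne_zero_of_ne_bot h
    refine ⟨‖e‖⁻¹ • e, ?_, ?_⟩
    · rw [real_inner_smul_left, real_inner_comm,
        Submodule.mem_orthogonal_singleton_iff_inner_right.mp he,
        mul_zero]
    · rw [real_inner_self_eq_norm_sq, norm_smul, norm_inv, norm_norm,
        inv_mul_cancel₀ (norm_ne_zero_iff.mpr h0), one_pow]
  have h1 : clTrace S (clι v * clι e * clι e) = -clTrace S (clι v) := by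
    rw [mul_assoc, clι_mul_self_of_unit he1, mul_neg_one, map_neg]
  have h2 : clTrace S (clι v * clι e * clι e) = clTrace S (clι v) := by
    rw [clTrace_mul_comm, clι_anticomm (by rw [real_inner_comm, he]), mul_neg, ← mul_assoc,
      clι_mul_self_of_unit he1, neg_one_mul, neg_neg]
  exact self_eq_neg.mp (h2.symm.trans h1)

include hs in
/-- Failure of surjectivity for a dihedral group whose rotation subgroup has odd order. -/
theorem exists_spinMap_ne_of_odd (hE : Module.finrank ℝ E = 2)
    (hW : W = Subgroup.closure (Set.range s)) (hn : Odd (orderOf (s 0 * s 1))) :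
    ∃ y ∈ genuinePart (coverMap W), ∀ σ, spinMap W S σ ≠ y := by
  have : FiniteDimensional ℝ E := Module.finite_of_finrank_pos (by omega)
  have := cover_finite W
  have hsW : ∀ i, s i ∈ W := fun i => by rw [hW]; exact Subgroup.subset_closure ⟨i, rfl⟩
  let g : cover W := ⟨(hs 0).lift, by
    change pinHom E _ ∈ W
    rw [(hs 0).pinHom_lift]; exact hsW 0⟩
  refine exists_notMem_range_tensorMap (p := coverMap W) (z := coverNegOne W) (g := g) _
    (coverMap_coverNegOne W) (eq_one_or_of_coverMap_eq_one W) (coverNegOne_comm W)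
    (coverNegOne_mul_self W) ?_ ?_
  · rw [character_spinRep]
    exact clTrace_clι_eq_zero S (by omega) (u 0)
  · intro h hh
    -- An even `k` taking the lift to its negative projects to a rotation that negates `u 0`, hence
    -- to -1, of order 2 in a cyclic group of odd order.
    have key : ∀ k : Pin E, k * (hs 0).lift * k⁻¹ = pinNegOne * (hs 0).lift →
        ∀ l : List (Fin 2), pinHom E k = (l.map s).prod → Even l.length →
        ((k : (Cl E)ˣ) : Cl E) = clProd (l.map u) ∨
          ((k : (Cl E)ˣ) : Cl E) = -clProd (l.map u) → False := by
      intro k hk l hl heven hkl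
      have h1 := involute_mul_clι k (u 0)
      have h2 : CliffordAlgebra.involute ((k : (Cl E)ˣ) : Cl E) = ((k : (Cl E)ˣ) : Cl E) := by
        have := involute_clProd (l.map u)
        rw [List.length_map, heven.neg_one_pow, one_smul] at this
        rcases hkl with hkl | hkl <;> rw [hkl]
        · exact this
        · rw [map_neg, this]
      have h3 : ((k : (Cl E)ˣ) : Cl E) * clι (u 0) = -clι (u 0) * ((k : (Cl E)ˣ) : Cl E) := by
        rw [mul_inv_eq_iff_eq_mul] at hk
        have := congrArg (fun a : Pin E => ((a : (Cl E)ˣ) : Cl E)) hk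
        simpa [coe_pinNegOne, (hs 0).coe_lift] using this
      rw [h2, h3, Units.mul_left_inj] at h1
      have h4 : -u 0 = pinHom E k (u 0) := ι_injective E (by rw [map_neg]; exact h1)
      rw [hl] at h4
      have h5 := eq_neg_of_apply_eq_neg hs hE heven h4.symm
      have h6 := (prod_mem_zpowers hs l).1 heven
      rw [h5] at h6
      have h7 := orderOf_dvd_of_mem_zpowers h6
      have h8 : orderOf (LinearEquiv.neg ℝ : E ≃ₗ[ℝ] E) = 2 := by
        refine orderOf_eq_prime (LinearEquiv.ext fun v => by simp [pow_two,
            LinearEquiv.mul_apply]) ?_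
        intro h
        have h9 := LinearEquiv.congr_fun h (u 0)
        have h10 : -u 0 = u 0 := h9
        have := (hs 0).inner_self
        have h11 : u 0 = 0 := by
          have h12 : (2 : ℝ) • u 0 = 0 := by rw [two_smul, ← neg_eq_iff_add_eq_zero, h10]
          exact (smul_eq_zero.mp h12).resolve_left two_ne_zero
        rw [h11, inner_zero_left] at this
        exact zero_ne_one this
      rw [h8] at h7
      exact Nat.not_even_iff_odd.mpr hn (even_iff_two_dvd.mpr h7)
    have hh' : (h : Pin E) * (hs 0).lift * (h : Pin E)⁻¹ = pinNegOne * (hs 0).lift :=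
      congrArg Subtype.val hh
    obtain ⟨l, hl, hl'⟩ := exists_list_of_mem_cover hs hW h
    by_cases he : Even l.length
    · exact key h hh' l hl he hl'
    -- The lift commutes with itself, so multiplying an odd conjugating element by it makes the
    -- element even without changing the conjugate.
    · refine key (h * (hs 0).lift) ?_ (l ++ [0]) ?_ ?_ ?_
      · rw [← hh']; group
      · rw [map_mul, hl, (hs 0).pinHom_lift]; simp
      · simpa [Nat.even_add_one] using he
      · rcases hl' with hl' | hl' <;> simp [hl', (hs 0).coe_lift]

end

end DihedralTypes

/-! ### Simple roots: generation by simple reflections and the Gram matrix -/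

section SimpleBasis

variable {ι b E : Type*} [NormedAddCommGroup E] [InnerProductSpace ℝ E]

/-- The vectors `u i` with the reflections `r i` are the unit roots of a finite reflection group,
and the basis `B` consists of the simple ones among them, with the indices `α s`. -/
structure IsSimpleBasis (u : ι → E) (r : ι → E ≃ₗ[ℝ] E) (B : Module.Basis b ℝ E) (α : b → ι) :
    Prop where
  isReflectionIn : ∀ i, IsReflectionIn (r i) (u i)
  exists_apply_eq : ∀ i j, ∃ k, r i (u j) = u k
  apply_eq : ∀ s, B s = u (α s)
  nonneg_or_nonpos : ∀ i, (∀ s, 0 ≤ B.repr (u i) s) ∨ (∀ s, B.repr (u i) s ≤ 0)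

namespace IsSimpleBasis

variable {u : ι → E} {r : ι → E ≃ₗ[ℝ] E} {B : Module.Basis b ℝ E} {α : b → ι}
  (h : IsSimpleBasis u r B α)

include h

lemma exists_apply_eq_of_mem {w : E ≃ₗ[ℝ] E} (hw : w ∈ Subgroup.closure (Set.range r)) (j : ι) :
    ∃ k, w (u j) = u k := by
  obtain ⟨l, rfl⟩ := exists_list_of_mem_closure_reflections h.isReflectionIn hw
  induction l with
  | nil => exact ⟨j, rfl⟩
  | cons i l ih =>
    obtain ⟨k, hk⟩ := ih (Subgroup.list_prod_mem _ (by
      intro x hx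
      obtain ⟨i, -, rfl⟩ := List.mem_map.mp hx
      exact Subgroup.subset_closure ⟨i, rfl⟩))
    rw [List.map_cons, List.prod_cons, LinearEquiv.mul_apply, hk]
    exact h.exists_apply_eq i k

/-- The group permutes the finitely many roots, and an element is determined by the roots to which
it sends the basis. -/
lemma finite_closure [Finite ι] [Finite b] : Finite (Subgroup.closure (Set.range r)) := by
  choose f hf using fun (w : Subgroup.closure (Set.range r)) (s : b) =>
    h.exists_apply_eq_of_mem w.2 (α s)
  refine Finite.of_injective f fun w w' hww => Subtype.ext (LinearEquiv.toLinearMap_injective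
    (B.ext fun s => ?_))
  change w.1 (B s) = w'.1 (B s)
  rw [h.apply_eq, hf, hf, hww]

lemma eq_of_eq_or_eq_neg {i j : ι} (hij : u i = u j ∨ u i = -u j) : r i = r j := by
  refine LinearEquiv.ext fun x => ?_
  rw [(h.isReflectionIn i).apply_eq, (h.isReflectionIn j).apply_eq]
  rcases hij with hij | hij <;> rw [hij]
  rw [inner_neg_right]
  module

/-- The simple reflections generate the reflection group. -/
lemma closure_eq [Finite ι] [Fintype b] :
    Subgroup.closure (Set.range r) = Subgroup.closure (Set.range fun s => r (α s)) := by
  apply le_antisymm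
  swap
  · rw [Subgroup.closure_le]
    rintro _ ⟨s, rfl⟩
    exact Subgroup.subset_closure ⟨_, rfl⟩
  rw [Subgroup.closure_le]
  set W := Subgroup.closure (Set.range fun s => r (α s))
  have hsW : ∀ s, r (α s) ∈ W := fun s => Subgroup.subset_closure ⟨s, rfl⟩
  have pos : ∀ i, (∀ s, 0 ≤ B.repr (u i) s) → r i ∈ W := by
    by_contra! hbad
    let X := {i | (∀ s, 0 ≤ B.repr (u i) s) ∧ r i ∉ W}
    -- A positive root of least coefficient sum whose reflection is not in `W`. As its norm is
    -- positive, it has positive inner product with some simple root in its support, and that simple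
    -- reflection lowers the sum.
    obtain ⟨i, hi, hmin⟩ := Set.exists_min_image X (fun i => ∑ s, B.repr (u i) s) X.toFinite hbad
    obtain ⟨s, hs0, hs⟩ : ∃ s, 0 < B.repr (u i) s ∧ 0 < inner ℝ (u i) (u (α s)) := by
      by_contra! hc
      have h1 : inner ℝ (u i) (u i) = ∑ s, B.repr (u i) s * inner ℝ (u i) (u (α s)) := by
        conv_lhs => rw [← B.sum_repr (u i)]
        rw [sum_inner]
        refine Finset.sum_congr rfl fun s _ => ?_
        rw [real_inner_smul_left, B.sum_repr, h.apply_eq, real_inner_comm]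
      rw [(h.isReflectionIn i).inner_self] at h1
      have h2 : ∑ s, B.repr (u i) s * inner ℝ (u i) (u (α s)) ≤ 0 := by
        refine Finset.sum_nonpos fun s _ => ?_
        rcases (hi.1 s).eq_or_lt with h3 | h3
        · rw [← h3, zero_mul]
        · exact mul_nonpos_of_nonneg_of_nonpos h3.le (hc s h3)
      linarith
    obtain ⟨j, hj⟩ := h.exists_apply_eq (α s) i
    have hrj : r j = r (α s) * r i * (r (α s))⁻¹ := by
      have h1 := (h.isReflectionIn i).conj (h.isReflectionIn (α s)).inner_map_map
      refine LinearEquiv.ext fun x => ?_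
      rw [h1.apply_eq, (h.isReflectionIn j).apply_eq, hj]
    have hrjW : r j ∉ W := by
      intro hc
      rw [hrj] at hc
      exact hi.2 ((W.mul_mem_cancel_left (hsW s)).mp
        ((W.mul_mem_cancel_right (W.inv_mem (hsW s))).mp hc))
    have hrepr : ∀ t, B.repr (u j) t =
        B.repr (u i) t - 2 * inner ℝ (u i) (u (α s)) * (Finsupp.single s 1 t : ℝ) := by
      intro t
      rw [← hj, (h.isReflectionIn _).apply_eq, map_sub, map_smul, ← h.apply_eq s, B.repr_self]
      rfl
    rcases h.nonneg_or_nonpos j with hpos | hneg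
    · have h1 := hmin j ⟨hpos, hrjW⟩
      simp only [hrepr, Finset.sum_sub_distrib, ← Finset.mul_sum] at h1
      classical
      simp [Finsupp.single_apply] at h1
      linarith
    -- The reflection changes only the coefficient at `s`, so it can turn the root negative only if
    -- the root is a multiple of the simple root, hence equal to it.
    · apply hi.2
      have h1 : u i = B.repr (u i) s • u (α s) := by
        conv_lhs => rw [← B.sum_repr (u i)]
        rw [Finset.sum_eq_single s, h.apply_eq]
        · intro t _ hts
          have h2 := hneg t
          rw [hrepr, Finsupp.single_eq_of_ne hts, mul_zero, sub_zero] at h2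
          rw [le_antisymm h2 (hi.1 t), zero_smul]
        · simp
      have h2 : B.repr (u i) s = 1 := by
        have h3 := (h.isReflectionIn i).inner_self
        rw [h1, real_inner_smul_left, real_inner_smul_right,
          (h.isReflectionIn (α s)).inner_self] at h3
        nlinarith
      rw [h2, one_smul] at h1
      rw [h.eq_of_eq_or_eq_neg (Or.inl h1)]
      exact hsW s
  rintro _ ⟨i, rfl⟩
  rcases h.nonneg_or_nonpos i with hi | hi
  · exact pos i hi
  · obtain ⟨k, hk⟩ := h.exists_apply_eq i i
    rw [(h.isReflectionIn i).apply_self] at hk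
    rw [h.eq_of_eq_or_eq_neg (j := k) (Or.inr (by rw [← hk, neg_neg]))]
    refine pos k fun s => ?_
    rw [← hk, map_neg]
    simpa using hi s

section Gram

variable {s t : b} (hst : s ≠ t)

lemma apply_left (p q : ℝ) : r (α s) (p • u (α s) + q • u (α t)) =
    (-p - 2 * inner ℝ (u (α s)) (u (α t)) * q) • u (α s) + q • u (α t) := by
  rw [map_add, map_smul, map_smul, (h.isReflectionIn _).apply_self,
    (h.isReflectionIn _).apply_eq (u (α t)), real_inner_comm]
  module

lemma apply_right (p q : ℝ) : r (α t) (p • u (α s) + q • u (α t)) =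
    p • u (α s) + (-q - 2 * inner ℝ (u (α s)) (u (α t)) * p) • u (α t) := by
  rw [map_add, map_smul, map_smul, (h.isReflectionIn _).apply_self,
    (h.isReflectionIn _).apply_eq (u (α s))]
  module

include hst

lemma repr_left (p q : ℝ) : B.repr (p • u (α s) + q • u (α t)) s = p := by
  rw [← h.apply_eq, ← h.apply_eq, map_add, map_smul, map_smul, B.repr_self, B.repr_self]
  simp [Finsupp.single_eq_of_ne hst]

lemma repr_right (p q : ℝ) : B.repr (p • u (α s) + q • u (α t)) t = q := by
  rw [← h.apply_eq, ← h.apply_eq, map_add, map_smul, map_smul, B.repr_self, B.repr_self]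
  simp [Finsupp.single_eq_of_ne hst.symm]

/-- The simple reflection at `s` sends the root at `t` to a root with coefficient 1 at `t`, so its
coefficient at `s`, which is -2 times the inner product, cannot be negative. -/
lemma inner_nonpos : inner ℝ (u (α s)) (u (α t)) ≤ 0 := by
  obtain ⟨k, hk⟩ := h.exists_apply_eq (α s) (α t)
  have h1 : u k = (-0 - 2 * inner ℝ (u (α s)) (u (α t)) * 1) • u (α s) + (1 : ℝ) • u (α t) := by
    rw [← hk, ← h.apply_left, zero_smul, zero_add, one_smul]
  rcases h.nonneg_or_nonpos k with h2 | h2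
  · have := h2 s
    rw [h1, h.repr_left hst] at this
    linarith
  · have := h2 t
    rw [h1, h.repr_right hst] at this
    linarith

lemma inner_of_orderOf_eq_two (ho : orderOf (r (α s) * r (α t)) = 2) :
    inner ℝ (u (α s)) (u (α t)) = 0 := by
  have h1 : r (α s) * r (α t) = r (α t) * r (α s) := by
    have h2 := pow_orderOf_eq_one (r (α s) * r (α t))
    rw [ho, pow_two] at h2
    rw [eq_inv_of_mul_eq_one_left h2, mul_inv_rev, (h.isReflectionIn _).inv_eq,
      (h.isReflectionIn _).inv_eq]
  have h2 := LinearEquiv.congr_fun h1 ((1 : ℝ) • u (α s) + (0 : ℝ) • u (α t))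
  simp only [LinearEquiv.mul_apply, h.apply_left, h.apply_right] at h2
  have h3 := congrArg (fun x => B.repr x t) h2
  simp only [h.repr_right hst] at h3
  linarith

/-- Applying the braid relation to a simple root gives `4 x ^ 2 = 1` for the inner product `x`, and
`x` is not positive. -/
lemma inner_of_orderOf_eq_three (ho : orderOf (r (α s) * r (α t)) = 3) :
    inner ℝ (u (α s)) (u (α t)) = -1 / 2 := by
  have h1 : r (α s) * r (α t) * r (α s) = r (α t) * r (α s) * r (α t) := by
    have h2 := pow_orderOf_eq_one (r (α s) * r (α t))
    rw [ho] at h2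
    have h3 : r (α s) * r (α t) * r (α s) * (r (α t) * r (α s) * r (α t)) = 1 := by
      rw [← h2]; simp only [pow_succ, pow_zero, one_mul, mul_assoc]
    rw [eq_inv_of_mul_eq_one_left h3]
    simp only [mul_inv_rev, (h.isReflectionIn _).inv_eq, mul_assoc]
  have h2 := LinearEquiv.congr_fun h1 ((1 : ℝ) • u (α s) + (0 : ℝ) • u (α t))
  simp only [LinearEquiv.mul_apply, h.apply_left, h.apply_right] at h2
  have h3 := congrArg (fun x => B.repr x s) h2
  simp only [h.repr_left hst] at h3
  have h4 := h.inner_nonpos hst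
  have h5 : (2 * inner ℝ (u (α s)) (u (α t)) - 1) * (2 * inner ℝ (u (α s)) (u (α t)) + 1) = 0 := by
    linarith
  rcases mul_eq_zero.mp h5 with h6 | h6 <;> linarith

/-- The braid relation leaves `±φ` and `±(1 - φ)` for twice the inner product. The sign leaves `-φ`
and `1 - φ`; the latter belongs to a pair of roots that also has product of order 5 but is not
simple. -/
lemma inner_of_orderOf_eq_five (ho : orderOf (r (α s) * r (α t)) = 5) :
    inner ℝ (u (α s)) (u (α t)) = -Real.goldenRatio / 2 := by
  have h1 : r (α s) * r (α t) * r (α s) * r (α t) * r (α s) =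
      r (α t) * r (α s) * r (α t) * r (α s) * r (α t) := by
    have h2 := pow_orderOf_eq_one (r (α s) * r (α t))
    rw [ho] at h2
    have h3 : r (α s) * r (α t) * r (α s) * r (α t) * r (α s) *
        (r (α t) * r (α s) * r (α t) * r (α s) * r (α t)) = 1 := by
      rw [← h2]; simp only [pow_succ, pow_zero, one_mul, mul_assoc]
    rw [eq_inv_of_mul_eq_one_left h3]
    simp only [mul_inv_rev, (h.isReflectionIn _).inv_eq, mul_assoc]
  have h2 := LinearEquiv.congr_fun h1 ((1 : ℝ) • u (α s) + (0 : ℝ) • u (α t))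
  simp only [LinearEquiv.mul_apply, h.apply_left, h.apply_right] at h2
  have h3 := congrArg (fun x => B.repr x s) h2
  simp only [h.repr_left hst] at h3
  obtain ⟨k, hk⟩ := h.exists_apply_eq (α t) (α s)
  obtain ⟨k', hk'⟩ := h.exists_apply_eq (α s) k
  have h4 : u k' = r (α s) (r (α t) ((1 : ℝ) • u (α s) + (0 : ℝ) • u (α t))) := by
    rw [← hk', ← hk, one_smul, zero_smul, add_zero]
  simp only [h.apply_left, h.apply_right] at h4
  have h5 := h.inner_nonpos hst
  have h6 := h.nonneg_or_nonpos k'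
  have h7 : (0 ≤ B.repr (u k') s ∧ 0 ≤ B.repr (u k') t) ∨
      (B.repr (u k') s ≤ 0 ∧ B.repr (u k') t ≤ 0) :=
    h6.imp (fun h => ⟨h s, h t⟩) (fun h => ⟨h s, h t⟩)
  rw [h4, h.repr_left hst, h.repr_right hst] at h7
  generalize inner ℝ (u (α s)) (u (α t)) = x at *
  have h8 := Real.goldenRatio_sq
  have h9 := Real.goldenRatio_pos
  have h10 := Real.one_lt_goldenRatio
  generalize Real.goldenRatio = φ at *
  have h11 : (2 * x + φ) * (2 * x - φ) * (2 * x - (1 - φ)) * (2 * x + (1 - φ)) = 0 := by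
    have : (4 * x ^ 2 - φ ^ 2) * (4 * x ^ 2 - (1 - φ) ^ 2) = 0 := by
      have h12 : (1 - φ) ^ 2 = 2 - φ := by linarith
      rw [h12, h8]
      linear_combination -h3 / 2 - h8
    linear_combination this
  rcases mul_eq_zero.mp h11 with h11 | h11
  · rcases mul_eq_zero.mp h11 with h11 | h11
    · rcases mul_eq_zero.mp h11 with h11 | h11 <;> linarith
    -- For `2 * x = 1 - φ` the root `r (α s) (r (α t) (u (α s)))` has coefficients `4 * x ^ 2 - 1 <
    -- 0` and `-2 * x > 0`.
    · exfalso
      have h12 : 2 * x = 1 - φ := by linarith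
      rw [h12] at h7
      rcases h7 with ⟨h13, h14⟩ | ⟨h13, h14⟩ <;> nlinarith
  · linarith

end Gram

end IsSimpleBasis

/-- A linear map that preserves the inner products of basis vectors is isometric. -/
lemma normSq_constr {B : Module.Basis b ℝ E} {q : b → Quaternion ℝ}
    (hq : ∀ s t, inner ℝ (q s) (q t) = inner ℝ (B s) (B t)) (v : E) :
    Quaternion.normSq (B.constr ℝ q v) = inner ℝ v v := by
  have h : (innerₗ (Quaternion ℝ)).compl₁₂ (B.constr ℝ q) (B.constr ℝ q) = innerₗ E :=
    LinearMap.ext_basis B B fun s t => by simp [hq]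
  rw [← Quaternion.inner_self]
  exact LinearMap.congr_fun₂ h v v

end SimpleBasis

/-! ### From the root pairing to unit coroots -/

section FromRootPairing

variable {ι b V₀ E : Type*} [Fintype b] [AddCommGroup V₀] [Module ℝ V₀]
  [NormedAddCommGroup E] [InnerProductSpace ℝ E] (P : RootPairing ι ℝ V₀ E)

lemma toLinearMap_reflection (i : ι) (x : V₀) (y : E) :
    P.toLinearMap (P.reflection i x) y = P.toLinearMap x (P.coreflection i y) :=
  LinearMap.congr_fun (LinearMap.congr_fun (P.reflection_dualMap_eq_coreflection i) y) x

/-- Products of two reflections and of the corresponding coreflections have equal orders. -/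
lemma orderOf_coreflection_mul (i j : ι) :
    orderOf (P.coreflection i * P.coreflection j) = orderOf (P.reflection i * P.reflection j) := by
  have h1 : P.coreflection i * P.coreflection j = (P.coreflection j * P.coreflection i)⁻¹ := by
    rw [mul_inv_rev, P.coreflection_inv, P.coreflection_inv]
  rw [h1, orderOf_inv, orderOf_eq_orderOf_iff]
  intro n
  -- Each coreflection is the transpose of the reflection, and transposing reverses products;
  -- perfectness of the pairing then makes one power trivial exactly when the other is.
  have h2 : ∀ x y, P.toLinearMap (((P.reflection i * P.reflection j) ^ n) x) y =
      P.toLinearMap x (((P.coreflection j * P.coreflection i) ^ n) y) := by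
    induction n with
    | zero => exact fun _ _ => rfl
    | succ n ih =>
      intro x y
      rw [pow_succ', pow_succ, LinearEquiv.mul_apply, LinearEquiv.mul_apply,
        LinearEquiv.mul_apply (_ ^ n), ← ih, toLinearMap_reflection, toLinearMap_reflection]
      rfl
  constructor <;> intro h <;> rw [h] at h2
  · exact LinearEquiv.ext fun x => P.toPerfPair.injective (LinearMap.ext fun y => h2 x y)
  · exact LinearEquiv.ext fun y => P.toLinearMap.flip.toPerfPair.injective
      (LinearMap.ext fun x => (h2 x y).symm)

variable (hinv : ∀ (i : ι) (x y : E),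
  inner ℝ (P.coreflection i x) (P.coreflection i y) = inner ℝ x y)

-- Comparing the inner product of `x` and the coroot with that of their images under the
-- coreflection, which negates the coroot, expresses the root through the metric.
include hinv in
lemma toLinearMap_root_mul (i : ι) (x : E) :
    P.toLinearMap (P.root i) x * inner ℝ (P.coroot i) (P.coroot i) =
      2 * inner ℝ x (P.coroot i) := by
  have h := hinv i x (P.coroot i)
  rw [P.coreflection_apply_self, P.coreflection_apply, inner_neg_right, inner_sub_left,
    real_inner_smul_left] at h
  change -(inner ℝ x (P.coroot i) - P.toLinearMap (P.root i) x * _) = _ at h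
  linarith

/-- The unit coroots. -/
def unitCoroot (i : ι) : E := ‖P.coroot i‖⁻¹ • P.coroot i

lemma norm_coroot_pos (i : ι) : 0 < ‖P.coroot i‖ := norm_pos_iff.mpr (P.ne_zero' i)

include hinv in
lemma toLinearMap_root (i : ι) (x : E) :
    P.toLinearMap (P.root i) x = inner ℝ ((2 / ‖P.coroot i‖) • unitCoroot P i) x := by
  have h := toLinearMap_root_mul P hinv i x
  have h0 := (norm_coroot_pos P i).ne'
  rw [real_inner_self_eq_norm_sq] at h
  rw [unitCoroot, smul_smul, real_inner_smul_left, real_inner_comm]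
  field_simp
  linarith

include hinv in
lemma isReflectionIn_unitCoroot (i : ι) :
    IsReflectionIn (P.coreflection i) (unitCoroot P i) where
  inner_self := by
    have h0 := (norm_coroot_pos P i).ne'
    rw [real_inner_self_eq_norm_sq, unitCoroot, norm_smul, norm_inv, norm_norm,
      inv_mul_cancel₀ h0, one_pow]
  apply_eq x := by
    have h0 := (norm_coroot_pos P i).ne'
    rw [P.coreflection_apply]
    change x - P.toLinearMap (P.root i) x • _ = _
    rw [toLinearMap_root P hinv, real_inner_smul_left, real_inner_comm]
    congr 1
    generalize inner ℝ x (unitCoroot P i) = c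
    rw [unitCoroot, smul_smul]
    congr 1
    field_simp

include hinv in
lemma coreflection_unitCoroot (i j : ι) :
    P.coreflection i (unitCoroot P j) = unitCoroot P (P.reflectionPerm i j) := by
  have h : ‖P.coroot (P.reflectionPerm i j)‖ = ‖P.coroot j‖ := by
    rw [P.coroot_reflectionPerm, norm_eq_sqrt_real_inner, hinv, ← norm_eq_sqrt_real_inner]
  rw [unitCoroot, unitCoroot, h, map_smul, P.coroot_reflectionPerm]

-- The metric identifies each root with a positive multiple of its unit coroot, so simplicity
-- carries over: independence and the signs of coefficients survive positive rescaling.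
include hinv in
lemma exists_isSimpleBasis [P.IsRootSystem] {α : b → ι} (hα : IsSimpleSystem P α) :
    ∃ B : Module.Basis b ℝ E, IsSimpleBasis (unitCoroot P) P.coreflection B α := by
  have hsum : ∀ i, ∃ c : b → ℝ, unitCoroot P i = ∑ s, c s • unitCoroot P (α s) ∧
      ((∀ s, 0 ≤ c s) ∨ (∀ s, c s ≤ 0)) := by
    intro i
    obtain ⟨c, hc, hsign⟩ := hα.nonneg_or_nonpos i
    have h0 := norm_coroot_pos P i
    -- The root is `2 / ‖P.coroot i‖` times the unit coroot; these factors convert the coefficients.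
    refine ⟨fun s => ‖P.coroot i‖ / 2 * (c s * (2 / ‖P.coroot (α s)‖)), ?_, ?_⟩
    · refine ext_inner_right ℝ fun x => ?_
      have h1 := congrArg (fun y => P.toLinearMap y x) hc
      simp only [map_sum, map_smul, LinearMap.sum_apply, LinearMap.smul_apply,
        toLinearMap_root P hinv, real_inner_smul_left, smul_eq_mul] at h1
      simp only [sum_inner, real_inner_smul_left, mul_assoc]
      rw [← Finset.mul_sum, ← h1]
      field_simp
    · refine hsign.imp (fun h s => ?_) (fun h s => ?_)
      · have := norm_coroot_pos P (α s)
        have := h s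
        positivity
      · have := norm_coroot_pos P (α s)
        have h2 : 0 ≤ ‖P.coroot i‖ / 2 * (2 / ‖P.coroot (α s)‖) := by positivity
        nlinarith [mul_nonneg h2 (neg_nonneg.mpr (h s))]
  have hli : LinearIndependent ℝ fun s => unitCoroot P (α s) := by
    rw [Fintype.linearIndependent_iff]
    intro g hg s
    have h1 : ∑ s, (g s * (‖P.coroot (α s)‖ / 2)) • P.root (α s) = 0 := by
      refine P.toPerfPair.injective (LinearMap.ext fun x => ?_)
      change P.toLinearMap _ x = P.toLinearMap 0 x
      have h2 := congrArg (fun y => inner ℝ y x) hg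
      simp only [sum_inner, real_inner_smul_left, inner_zero_left] at h2
      simp only [map_sum, map_smul, LinearMap.sum_apply, LinearMap.smul_apply,
        toLinearMap_root P hinv, real_inner_smul_left, smul_eq_mul, map_zero, LinearMap.zero_apply]
      rw [← h2]
      refine Finset.sum_congr rfl fun s _ => ?_
      have := (norm_coroot_pos P (α s)).ne'
      field_simp
    have h3 := Fintype.linearIndependent_iff.mp hα.linearIndependent _ h1 s
    exact (mul_eq_zero.mp h3).resolve_right (by have := norm_coroot_pos P (α s); positivity)
  have hspan : ⊤ ≤ Submodule.span ℝ (Set.range fun s => unitCoroot P (α s)) := by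
    rw [← RootPairing.IsRootSystem.span_coroot_eq_top (P := P), Submodule.span_le]
    rintro _ ⟨i, rfl⟩
    have h0 := (norm_coroot_pos P i).ne'
    have h1 : P.coroot i = ‖P.coroot i‖ • unitCoroot P i := by
      rw [unitCoroot, smul_smul, mul_inv_cancel₀ h0, one_smul]
    obtain ⟨c, hc, -⟩ := hsum i
    rw [h1, hc]
    exact Submodule.smul_mem _ _ (Submodule.sum_mem _ fun s _ =>
      Submodule.smul_mem _ _ (Submodule.subset_span ⟨s, rfl⟩))
  refine ⟨Module.Basis.mk hli hspan, isReflectionIn_unitCoroot P hinv,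
    fun i j => ⟨_, coreflection_unitCoroot P hinv i j⟩, fun s => by simp, fun i => ?_⟩
  obtain ⟨c, hc, hsign⟩ := hsum i
  have h1 : ∀ s, (Module.Basis.mk hli hspan).repr (unitCoroot P i) s = c s := by
    intro s
    have : unitCoroot P i = ∑ s, c s • Module.Basis.mk hli hspan s := by simpa using hc
    rw [this, Module.Basis.repr_sum_self]
  simpa only [h1] using hsign

end FromRootPairing

/-! ### The individual types -/

section Main

variable {ι V₀ E : Type*} [Finite ι] [AddCommGroup V₀] [Module ℝ V₀]
  [NormedAddCommGroup E] [InnerProductSpace ℝ E]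
  (P : RootPairing ι ℝ V₀ E) [P.IsRootSystem]
  (hinv : ∀ (i : ι) (x y : E), inner ℝ (P.coreflection i x) (P.coreflection i y) = inner ℝ x y)
  (S : Type) [AddCommGroup S] [Module ℂ S] [Module (ClC E) S] [IsScalarTower ℂ (ClC E) S]
  [Module.Finite ℂ S]

lemma finite_reflectionGroup_of_hasCoxeterType (hinv : ∀ (i : ι) (x y : E),
    inner ℝ (P.coreflection i x) (P.coreflection i y) = inner ℝ x y) {b : Type*} [Fintype b]
    {M : CoxeterMatrix b} (hP : HasCoxeterType P M) :
    FiniteDimensional ℝ E ∧ Finite (reflectionGroup P) := by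
  obtain ⟨α, hα, -⟩ := hP
  obtain ⟨B, hB⟩ := exists_isSimpleBasis P hinv hα
  exact ⟨Module.Finite.of_basis B, hB.finite_closure⟩

lemma spinMap_mem_genuinePart [FiniteDimensional ℝ E] (W : Subgroup (E ≃ₗ[ℝ] E)) [Finite W]
    (σ : RepRing W) : spinMap W S σ ∈ genuinePart (coverMap W) := by
  have := cover_finite W
  exact tensorMap_mem_genuinePart _ _ (coverMap_coverNegOne W) (spinRep_coverNegOne S W) σ

include hinv

/-- The Coxeter orders fix the Gram matrix of the unit simple coroots, and it is that of the
icosians `qSimple`; the linear map matching the two is therefore isometric. -/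
theorem exists_spinMap_eq_of_isTypeH₄ [IsSimpleModule (ClC E) S] (hP : IsTypeH₄ P)
    {y : RepRing (cover (reflectionGroup P))}
        (hy : y ∈ genuinePart (coverMap (reflectionGroup P))) :
    ∃ σ, spinMap (reflectionGroup P) S σ = y := by
  obtain ⟨_, _⟩ := finite_reflectionGroup_of_hasCoxeterType P hinv hP
  obtain ⟨α, hα, hM⟩ := hP
  obtain ⟨B, hB⟩ := exists_isSimpleBasis P hinv hα
  have ho : ∀ s t, orderOf (P.coreflection (α s) * P.coreflection (α t)) = CoxeterMatrix.H₄ s t :=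
    fun s t => by rw [orderOf_coreflection_mul, hM]
  have hlt : ∀ s t, s < t → inner ℝ (qSimple s).toQuat (qSimple t).toQuat =
      inner ℝ (unitCoroot P (α s)) (unitCoroot P (α t)) := by
    intro s t hst
    have h2 := hB.inner_of_orderOf_eq_two hst.ne
    have h3 := hB.inner_of_orderOf_eq_three hst.ne
    have h5 := hB.inner_of_orderOf_eq_five hst.ne
    rw [ho] at h2 h3 h5
    rw [QPhi.inner_toQuat]
    fin_cases s <;> fin_cases t <;> first | exact absurd hst (by decide) | skip
    · rw [h3 rfl]; norm_num [qSimple, QPhi.dot, ZPhi.mul, ZPhi.toReal]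
    · rw [h2 rfl]; norm_num [qSimple, QPhi.dot, ZPhi.mul, ZPhi.toReal]
    · rw [h2 rfl]; norm_num [qSimple, QPhi.dot, ZPhi.mul, ZPhi.toReal]
    · rw [h3 rfl]; norm_num [qSimple, QPhi.dot, ZPhi.mul, ZPhi.toReal]
    · rw [h2 rfl]; norm_num [qSimple, QPhi.dot, ZPhi.mul, ZPhi.toReal]
    · rw [h5 rfl]; norm_num [qSimple, QPhi.dot, ZPhi.mul, ZPhi.toReal]; ring
  have hq : ∀ s t, inner ℝ (qSimple s).toQuat (qSimple t).toQuat = inner ℝ (B s) (B t) := by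
    intro s t
    rw [hB.apply_eq, hB.apply_eq]
    rcases lt_trichotomy s t with h | rfl | h
    · exact hlt s t h
    · rw [inner_self_of_mem_unitIcosians (qSimple_mem_unitIcosians s),
        (hB.isReflectionIn _).inner_self]
    · rw [real_inner_comm, hlt t s h, real_inner_comm]
  exact exists_spinMap_eq_of_icosians (W := reflectionGroup P) (normSq_constr hq) S
      (fun s => hB.isReflectionIn (α s))
    hB.closure_eq (fun s => by rw [← hB.apply_eq, B.constr_basis]) hy

/-- As for `H₄`, with the last three simple icosians; these are pure, so the whole space maps to
pure quaternions. -/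
theorem exists_spinMap_eq_of_isTypeH₃ [IsSimpleModule (ClC E) S] (hP : IsTypeH₃ P)
    {y : RepRing (cover (reflectionGroup P))}
        (hy : y ∈ genuinePart (coverMap (reflectionGroup P))) :
    ∃ σ, spinMap (reflectionGroup P) S σ = y := by
  obtain ⟨_, _⟩ := finite_reflectionGroup_of_hasCoxeterType P hinv hP
  obtain ⟨α, hα, hM⟩ := hP
  obtain ⟨B, hB⟩ := exists_isSimpleBasis P hinv hα
  have ho : ∀ s t, orderOf (P.coreflection (α s) * P.coreflection (α t)) = CoxeterMatrix.H₃ s t :=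
    fun s t => by rw [orderOf_coreflection_mul, hM]
  have hlt : ∀ s t, s < t → inner ℝ (qSimple s.succ).toQuat (qSimple t.succ).toQuat =
      inner ℝ (unitCoroot P (α s)) (unitCoroot P (α t)) := by
    intro s t hst
    have h2 := hB.inner_of_orderOf_eq_two hst.ne
    have h3 := hB.inner_of_orderOf_eq_three hst.ne
    have h5 := hB.inner_of_orderOf_eq_five hst.ne
    rw [ho] at h2 h3 h5
    rw [QPhi.inner_toQuat]
    fin_cases s <;> fin_cases t <;> first | exact absurd hst (by decide) | skip
    · rw [h3 rfl]; norm_num [qSimple, QPhi.dot, ZPhi.mul, ZPhi.toReal]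
    · rw [h2 rfl]; norm_num [qSimple, QPhi.dot, ZPhi.mul, ZPhi.toReal]
    · rw [h5 rfl]; norm_num [qSimple, QPhi.dot, ZPhi.mul, ZPhi.toReal]; ring
  have hq : ∀ s t, inner ℝ (qSimple (Fin.succ s)).toQuat (qSimple (Fin.succ t)).toQuat =
      inner ℝ (B s) (B t) := by
    intro s t
    rw [hB.apply_eq, hB.apply_eq]
    rcases lt_trichotomy s t with h | rfl | h
    · exact hlt s t h
    · rw [inner_self_of_mem_unitIcosians (qSimple_mem_unitIcosians _),
        (hB.isReflectionIn _).inner_self]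
    · rw [real_inner_comm, hlt t s h, real_inner_comm]
  refine exists_spinMap_eq_of_icosians_pure (W := reflectionGroup P) (normSq_constr (B := B) hq) S
    (fun s => hB.isReflectionIn (α s)) hB.closure_eq
    (fun s => by rw [← hB.apply_eq, B.constr_basis]) (fun v => ?_) hy
  have h0 : ∀ i : Fin 3, (qSimple i.succ).toQuat.re = 0 := by
    intro i
    have h := congrArg (·.re) (neg_star_qSimple_succ i)
    simp only [Quaternion.re_neg, Quaternion.re_star] at h
    linarith
  rw [B.constr_apply_fintype ℝ, Fin.sum_univ_three]
  simp only [Quaternion.re_add, Quaternion.re_smul, h0, smul_zero, add_zero]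

theorem exists_spinMap_eq_of_isTypeI₂ [IsSimpleModule (ClC E) S] {n : ℕ} (hn : Even n)
    (hP : IsTypeI₂ P n)
    {y : RepRing (cover (reflectionGroup P))}
        (hy : y ∈ genuinePart (coverMap (reflectionGroup P))) :
    ∃ σ, spinMap (reflectionGroup P) S σ = y := by
  obtain ⟨m, rfl, hP⟩ := hP
  obtain ⟨_, _⟩ := finite_reflectionGroup_of_hasCoxeterType P hinv hP
  obtain ⟨α, hα, hM⟩ := hP
  obtain ⟨B, hB⟩ := exists_isSimpleBasis P hinv hα
  have ho : orderOf (P.coreflection (α 0) * P.coreflection (α 1)) = m + 2 := by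
    rw [orderOf_coreflection_mul, hM]; rfl
  refine exists_spinMap_eq_of_even (W := reflectionGroup P) (fun s => hB.isReflectionIn (α s)) S
    (by rw [Module.finrank_eq_card_basis B, Fintype.card_fin]) hB.closure_eq ?_ ?_ hy
  · rw [ho]; omega
  · rwa [ho]

theorem exists_spinMap_ne_of_isTypeI₂ {n : ℕ} (hn : Odd n) (hP : IsTypeI₂ P n) :
    ∃ y ∈ genuinePart (coverMap (reflectionGroup P)), ∀ σ, spinMap (reflectionGroup P) S σ ≠ y := by
  obtain ⟨m, rfl, hP⟩ := hP
  obtain ⟨_, _⟩ := finite_reflectionGroup_of_hasCoxeterType P hinv hP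
  obtain ⟨α, hα, hM⟩ := hP
  obtain ⟨B, hB⟩ := exists_isSimpleBasis P hinv hα
  have ho : orderOf (P.coreflection (α 0) * P.coreflection (α 1)) = m + 2 := by
    rw [orderOf_coreflection_mul, hM]; rfl
  exact exists_spinMap_ne_of_odd (W := reflectionGroup P) (fun s => hB.isReflectionIn (α s)) S
    (by rw [Module.finrank_eq_card_basis B, Fintype.card_fin]) hB.closure_eq (by rwa [ho])

end Main
end SpinCover

end

open SpinCover in
theorem mainTheorem7 {ι V₀ E : Type*} [Finite ι] [AddCommGroup V₀] [Module ℝ V₀]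
    [NormedAddCommGroup E] [InnerProductSpace ℝ E]
    (P : RootPairing ι ℝ V₀ E) [P.IsRootSystem] [P.IsReduced]
    (hinv : ∀ (i : ι) (x y : E), inner ℝ (P.coreflection i x) (P.coreflection i y) = inner ℝ x y)
    (hP : (∃ n, 3 ≤ n ∧ IsTypeI₂ P n) ∨ IsTypeH₃ P ∨ IsTypeH₄ P)
    (S : Type) [AddCommGroup S] [Module ℂ S] [Module (ClC E) S] [IsScalarTower ℂ (ClC E) S]
    [IsSimpleModule (ClC E) S] [Module.Finite ℂ S] :
    ∃ h : ∀ σ : RepRing (reflectionGroup P),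
        spinMap (reflectionGroup P) S σ ∈ genuinePart (coverMap (reflectionGroup P)),
      Function.Surjective ((spinMap (reflectionGroup P) S).codRestrict
          (genuinePart (coverMap (reflectionGroup P))) h) ↔
        (∃ n, 3 ≤ n ∧ Even n ∧ IsTypeI₂ P n) ∨ IsTypeH₃ P ∨ IsTypeH₄ P := by
  obtain ⟨_, _⟩ : FiniteDimensional ℝ E ∧ Finite (reflectionGroup P) := by
    rcases hP with ⟨n, -, m, -, hP⟩ | hP | hP <;>
      exact finite_reflectionGroup_of_hasCoxeterType P hinv hP
  refine ⟨spinMap_mem_genuinePart S _, fun hsurj => ?_, fun hT => ?_⟩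
  -- No disjointness of types is needed: an odd dihedral description by itself contradicts
  -- surjectivity, and any other description is already one of the listed types.
  · rcases hP with ⟨n, hn, hP⟩ | hP
    · rcases Nat.even_or_odd n with he | hodd
      · exact Or.inl ⟨n, hn, he, hP⟩
      · obtain ⟨y, hy, hne⟩ := exists_spinMap_ne_of_isTypeI₂ P hinv S hodd hP
        obtain ⟨σ, hσ⟩ := hsurj ⟨y, hy⟩
        exact absurd (congrArg Subtype.val hσ) (hne σ)
    · exact Or.inr hP
  · rintro ⟨y, hy⟩
    obtain ⟨σ, hσ⟩ : ∃ σ, spinMap (reflectionGroup P) S σ = y := by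
      rcases hT with ⟨n, -, he, hT⟩ | hT | hT
      exacts [exists_spinMap_eq_of_isTypeI₂ P hinv S he hT hy,
        exists_spinMap_eq_of_isTypeH₃ P hinv S hT hy, exists_spinMap_eq_of_isTypeH₄ P hinv S hT hy]
    exact ⟨σ, Subtype.ext hσ⟩
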